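/- Let $p$ be a prime number. For $y\in\mathbb{R}$ let $\|y\|$ denote the distance from $y$ to the nearest integer. Let $x=[a_0;a_1,a_2,\ldots]\in\mathbb{R}$ be a counterexample to the $p$-adic Littlewood conjecture, i.e. $\liminf_{q\to\infty} q\cdot|q|_p\cdot\|qx\|\neq 0$ (such an $x$ is irrational). Let $w_{CF}(x)=a_1a_2a_3\ldots\in\mathbb{N}^{\mathbb{N}}$ be the infinite word of partial quotients of $x$, let $\mathrm{T}$ be the left shift on $\mathbb{N}^{\mathbb{N}}$, and let $\mathcal{W}_{CF}(x)$ be the set of limit points of the sequence $(\mathrm{T}^n w_{CF}(x))_{n\in\mathbb{N}}$ in the product topology ($\mathbb{N}$ being discrete). For an infinite word $w$ let $P(w,n)$ be the number of distinct blocks of length $n$ occurring in $w$. Then for every $w\in\mathcal{W}_{CF}(x)$, $$\lim_{n\to\infty}\bigl(P(w,n)-n\bigr)=\infty .$$ In particular, $\mathcal{W}_{CF}(x)$ contains no Sturmian word, i.e. no word $w$ with $P(w,n)=n+1$ for all $n\ge 0$. -/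

import Mathlib

open Filter Topology

namespace PLC

/-- The distance `‖y‖` from a real number to the nearest integer. -/
noncomputable def distInt (y : ℝ) : ℝ := |y - round y|

/-- `x` is a counterexample to the `p`-adic Littlewood conjecture:
`liminf_{q → ∞} q * |q|_p * ‖q x‖` is not zero. (The sequence is nonnegative, and it has
infinitely many terms `≤ 1` by Dirichlet's theorem, so this real `liminf` is the genuine one.) -/
def IsCounterexample (p : ℕ) [Fact p.Prime] (x : ℝ) : Prop :=
  liminf (fun q : ℕ => (q : ℝ) * ‖(q : ℚ_[p])‖ * distInt ((q : ℝ) * x)) atTop ≠ 0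

/-- The infinite word `a₁ a₂ a₃ …` of partial quotients of `x = [a₀; a₁, a₂, a₃, …]`; the letter
with index `n` is `a_{n+1}`. For rational `x` the expansion is finite and is padded with zeros;
no counterexample to the conjecture is rational. -/
noncomputable def cfWord (x : ℝ) : ℕ → ℕ :=
  fun n => ⌊((GenContFract.of x).partDens.get? n).getD 0⌋₊

/-- The `n`-th iterate `T^n` of the left shift on infinite words. -/
def shift (n : ℕ) (w : ℕ → ℕ) : ℕ → ℕ := fun i => w (n + i)

/-- The limit points of the sequence `T^n (cfWord x)`, in the product topology on `ℕ → ℕ`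
coming from the discrete topology on the letters. -/
def limitWords (x : ℝ) : Set (ℕ → ℕ) :=
  {w | MapClusterPt w atTop (fun n : ℕ => shift n (cfWord x))}

/-- The set of blocks (factors) of length `n` occurring in `w`. -/
def factors (w : ℕ → ℕ) (n : ℕ) : Set (Fin n → ℕ) :=
  Set.range fun i : ℕ => fun j : Fin n => w (i + j)

/-- The word complexity `P(w, n)`: the number of distinct blocks of length `n` occurring in `w`. -/
noncomputable def complexity (w : ℕ → ℕ) (n : ℕ) : ℕ := (factors w n).ncard

/-- A Sturmian word: exactly `n + 1` blocks of each length `n`. -/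
def IsSturmian (w : ℕ → ℕ) : Prop := ∀ n : ℕ, complexity w n = n + 1

end PLC

namespace PLC

open Matrix

/-! Write `θ_n = (q_n, q_{n-1})` for the state at time `n`. An integer form `z` gives `Q = z · θ_n`
with `|Q| ≤ |z| q_n` and `‖Q x‖ ≤ |z| / q_n`, so for a counterexample `c p^K ≤ |z|²` whenever `p^K`
divides a nonzero `z · θ_n`. This is `BadWord`; apart from it, only the boundedness of the partial
quotients is used.

The engine is `BadWord.exists_form`. Let `det γ = 1`, `γ ≡ 1` mod `p²`, and let `p^e` exactly divide
`wedge θ (γ θ)`. Pigeonhole gives a form `z` with `|z|²` of order `p^e` whose value at `θ` is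
divisible by `p^(e+1)` and whose value at `γ θ` has order exactly `e`. The function `m ↦ z · γ^m θ`
is `p`-adically almost affine, so a Hensel argument makes it divisible by `p^(e+K)` at bounded `m`.
If `γ^m θ` is congruent to a genuine state `θ_k`, badness forces `z · θ_k = 0`, which cannot happen
for two different `k ≥ 1`, nor for one large `k`.

In a long periodic stretch the vectors `γ^m θ` are themselves states, so long periods are excluded
(`BadWord.not_periodic`), also in limit words. By a Morse–Hedlund argument `P(n) - n` is then
nondecreasing. If it does not tend to infinity it is eventually constant, and each long length has
one right special factor, with two return words and return matrices `A`, `B`.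

High powers of `A` need not occur in the word. But modulo a power of `p` the recurrent states at
special factors form a finite set invariant under `A` and `B` (`SpecialWord.exists_invariant`), so
`A^m θ` is still congruent to a genuine late state and the engine applies to a power of `A` or of
`B`. One of the two wedges has bounded order: otherwise `θ` would be a common approximate
eigenvector, and too high a power of `p` would divide the determinant of the commutator, which is
nonzero (`Dominant.det_commutator_ne_zero`). -/

/-! ### Matrices of continued fraction blocks -/

/-- The matrix of one step of the recurrence `q_{n+1} = a q_n + q_{n-1}`. -/
def stepMat (a : ℕ) : Matrix (Fin 2) (Fin 2) ℤ := !![(a : ℤ), 1; 1, 0]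

/-- The product of the step matrices over the block of length `l` starting at `i`. -/
def blockMat (w : ℕ → ℕ) (i : ℕ) : ℕ → Matrix (Fin 2) (Fin 2) ℤ
  | 0 => 1
  | l + 1 => stepMat (w (i + l)) * blockMat w i l

/-- The vector `(q_n, q_{n-1})` of consecutive convergent denominators. -/
def denVec (w : ℕ → ℕ) (n : ℕ) : Fin 2 → ℤ := blockMat w 0 n *ᵥ ![1, 0]

theorem det_stepMat (a : ℕ) : (stepMat a).det = -1 := by
  simp [stepMat, Matrix.det_fin_two]

theorem blockMat_add (w : ℕ → ℕ) (i l k : ℕ) :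
    blockMat w i (l + k) = blockMat w (i + l) k * blockMat w i l := by
  induction k with
  | zero => simp [blockMat]
  | succ k ih =>
    rw [← add_assoc, blockMat, ih, blockMat, Matrix.mul_assoc, add_assoc]

theorem blockMat_congr {w w' : ℕ → ℕ} {i j l : ℕ} (h : ∀ k < l, w (i + k) = w' (j + k)) :
    blockMat w i l = blockMat w' j l := by
  induction l with
  | zero => rfl
  | succ l ih => rw [blockMat, blockMat, ih fun k hk => h k (by omega), h l (by omega)]

theorem det_blockMat_sq (w : ℕ → ℕ) (i l : ℕ) : (blockMat w i l).det ^ 2 = 1 := by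
  induction l with
  | zero => simp [blockMat]
  | succ l ih => rw [blockMat, Matrix.det_mul, mul_pow, ih, det_stepMat]; norm_num

theorem denVec_add (w : ℕ → ℕ) (n k : ℕ) :
    denVec w (n + k) = blockMat w n k *ᵥ denVec w n := by
  rw [denVec, blockMat_add, denVec, Matrix.mulVec_mulVec, zero_add]

theorem denVec_succ (w : ℕ → ℕ) (n : ℕ) :
    denVec w (n + 1) = ![w n * denVec w n 0 + denVec w n 1, denVec w n 0] := by
  rw [denVec_add]
  ext i
  fin_cases i <;> simp [blockMat, stepMat, Matrix.mulVec, dotProduct, Fin.sum_univ_two]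

theorem denVec_zero (w : ℕ → ℕ) : denVec w 0 = ![1, 0] := by
  simp [denVec, blockMat]

/-! ### Integer forms along the powers of a matrix -/

/-- Cayley–Hamilton for powers of a `2 × 2` matrix of determinant one. -/
theorem dotProduct_pow_rec (γ : Matrix (Fin 2) (Fin 2) ℤ) (hdet : γ.det = 1) (z θ : Fin 2 → ℤ)
    (m : ℕ) : z ⬝ᵥ (γ ^ (m + 2) *ᵥ θ) =
      γ.trace * (z ⬝ᵥ (γ ^ (m + 1) *ᵥ θ)) - z ⬝ᵥ (γ ^ m *ᵥ θ) := by
  have h : γ * γ = γ.trace • γ - 1 := by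
    rw [Matrix.det_fin_two] at hdet
    ext i j
    fin_cases i <;> fin_cases j <;>
      simp [-zsmul_eq_mul, Matrix.mul_apply, Fin.sum_univ_two, Matrix.trace_fin_two] <;> linarith
  have h2 : γ ^ (m + 2) = γ.trace • γ ^ (m + 1) - γ ^ m := by
    rw [pow_add, pow_two, h, mul_sub, mul_one, Matrix.mul_smul, pow_succ]
  rw [h2, Matrix.sub_mulVec, Matrix.smul_mulVec, dotProduct_sub, dotProduct_smul, smul_eq_mul]

/-- The second difference of `f` is `(t - 2) * f (m + 1)`, a multiple of `D * P`. -/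
theorem linear_mod_of_rec {P : ℤ} {D t : ℤ} (ht : P ∣ t - 2) {f : ℕ → ℤ}
    (hrec : ∀ m, f (m + 2) = t * f (m + 1) - f m) (h0 : D ∣ f 0) (h1 : D ∣ f 1) (m : ℕ) :
    D ∣ f m ∧ D * P ∣ f m - (f 0 + m * (f 1 - f 0)) := by
  suffices h : ∀ m, (D ∣ f m ∧ D * P ∣ f m - (f 0 + m * (f 1 - f 0))) ∧
      (D ∣ f (m + 1) ∧ D * P ∣ f (m + 1) - (f 0 + ((m + 1 : ℕ) : ℤ) * (f 1 - f 0))) from (h m).1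
  intro m
  induction m with
  | zero => simp [h0, h1]
  | succ m ih =>
    obtain ⟨⟨a1, a2⟩, b1, b2⟩ := ih
    refine ⟨⟨b1, b2⟩, ?_, ?_⟩
    · rw [hrec]; exact dvd_sub (b1.mul_left _) a1
    · have h3 : D * P ∣ (t - 2) * f (m + 1) := by
        rw [mul_comm]; exact mul_dvd_mul ht b1
      have := dvd_sub (dvd_add h3 (b2.mul_left 2)) a2
      have e : f (m + 2) - (f 0 + ((m + 1 + 1 : ℕ) : ℤ) * (f 1 - f 0)) =
          (t - 2) * f (m + 1) + 2 * (f (m + 1) - (f 0 + ((m + 1 : ℕ) : ℤ) * (f 1 - f 0))) -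
            (f m - (f 0 + m * (f 1 - f 0))) := by
        rw [hrec]; push_cast; ring
      rw [e]; exact this

theorem exists_one_add_smul_pow {P : ℤ} {γ : Matrix (Fin 2) (Fin 2) ℤ}
    (h : ∃ B : Matrix (Fin 2) (Fin 2) ℤ, γ = 1 + P • B) (m : ℕ) :
    ∃ B : Matrix (Fin 2) (Fin 2) ℤ, γ ^ m = 1 + P • B := by
  obtain ⟨B, hB⟩ := h
  induction m with
  | zero => exact ⟨0, by simp⟩
  | succ m ih =>
    obtain ⟨B', hB'⟩ := ih
    refine ⟨B + B' * γ, ?_⟩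
    rw [pow_succ, hB', add_mul, one_mul, Matrix.smul_mul, smul_add, ← add_assoc, ← hB]

/-- Along the powers of a unipotent-like matrix the form `z` vanishes to every `p`-adic order,
relative to its value at `γ θ`. -/
theorem exists_pow_dvd_dotProduct_pow {p : ℕ} (hp : p.Prime) (K : ℕ) :
    ∃ M : ℕ, ∀ (γ : Matrix (Fin 2) (Fin 2) ℤ) (z θ : Fin 2 → ℤ) (e : ℕ), γ.det = 1 →
      (∃ B : Matrix (Fin 2) (Fin 2) ℤ, γ = 1 + ((p : ℤ) ^ 2) • B) →
      (p : ℤ) ^ (e + 1) ∣ z ⬝ᵥ θ → (p : ℤ) ^ e ∣ z ⬝ᵥ (γ *ᵥ θ) →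
      ¬ (p : ℤ) ^ (e + 1) ∣ z ⬝ᵥ (γ *ᵥ θ) →
      ∃ m₁ m₂, m₁ < m₂ ∧ m₂ ≤ M ∧ (p : ℤ) ^ (e + K) ∣ z ⬝ᵥ (γ ^ m₁ *ᵥ θ) ∧
        (p : ℤ) ^ (e + K) ∣ z ⬝ᵥ (γ ^ m₂ *ᵥ θ) := by
  induction K with
  | zero =>
    refine ⟨1, fun γ z θ e _ _ h0 h1 _ => ⟨0, 1, by norm_num, le_rfl, ?_, ?_⟩⟩
    · simpa using (pow_dvd_pow _ (Nat.le_succ e)).trans h0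
    · simpa using h1
  | succ K ih =>
    obtain ⟨M, hM⟩ := ih
    -- The exponents found are `p * j + p * m` with `j < p` and `m ≤ M`.
    refine ⟨p * p + p * M, fun γ z θ e hdet hB h0 h1 h1' => ?_⟩
    have hp0 : (p : ℤ) ≠ 0 := by exact_mod_cast hp.ne_zero
    set f : ℕ → ℤ := fun m => z ⬝ᵥ (γ ^ m *ᵥ θ) with hf
    have ht : (p : ℤ) ^ 2 ∣ γ.trace - 2 := by
      obtain ⟨B, rfl⟩ := hB
      refine ⟨B.trace, ?_⟩
      simp [-zsmul_eq_mul, Matrix.trace_fin_two]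
    have f0 : f 0 = z ⬝ᵥ θ := by simp only [hf, pow_zero, Matrix.one_mulVec]
    have f1 : f 1 = z ⬝ᵥ (γ *ᵥ θ) := by simp only [hf, pow_one]
    rw [← f0] at h0
    rw [← f1] at h1 h1'
    have hlin : ∀ m : ℕ, (p : ℤ) ^ (e + 2) ∣ f m - (f 0 + m * (f 1 - f 0)) := fun m => by
      rw [pow_add]
      exact (linear_mod_of_rec ht (dotProduct_pow_rec γ hdet z θ)
        ((pow_dvd_pow _ (Nat.le_succ e)).trans h0) h1 m).2
    obtain ⟨u, hu⟩ := h0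
    obtain ⟨v, hv⟩ := h1
    have hpv : ¬ (p : ℤ) ∣ v := by
      rintro ⟨v', rfl⟩
      exact h1' ⟨v', by rw [hv]; ring⟩
    have hmul : ∀ j : ℕ, (p : ℤ) ^ (e + 2) ∣ f (p * j) - (p : ℤ) ^ (e + 1) * (u + j * v) := by
      intro j
      have := dvd_sub (hlin (p * j)) (Dvd.intro (j * u : ℤ) rfl : (p : ℤ) ^ (e + 2) ∣ _)
      have e' : f (p * j) - (p : ℤ) ^ (e + 1) * (u + j * v) =
          f (p * j) - (f 0 + ((p * j : ℕ) : ℤ) * (f 1 - f 0)) -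
            (p : ℤ) ^ (e + 2) * (j * u) := by
        rw [hu, hv]; push_cast; ring
      rw [e']; exact this
    -- Hensel step: `j` is the zero modulo `p` of the affine function `u + j v`. Restarting from `γ
    -- ^ (p * j) θ` with `γ ^ p` raises `e` by one.
    obtain ⟨j, hjp, hj⟩ : ∃ j : ℕ, j < p ∧ (p : ℤ) ∣ u + j * v := by
      have : Fact p.Prime := ⟨hp⟩
      have hv0 : (v : ZMod p) ≠ 0 := fun h => hpv ((ZMod.intCast_zmod_eq_zero_iff_dvd v p).mp h)
      refine ⟨(-(u : ZMod p) / v).val, ZMod.val_lt _, ?_⟩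
      rw [← ZMod.intCast_zmod_eq_zero_iff_dvd]
      push_cast
      rw [ZMod.natCast_val, ZMod.cast_id', id, div_mul_cancel₀ _ hv0]; ring
    have e0 : z ⬝ᵥ (γ ^ (p * j) *ᵥ θ) = f (p * j) := rfl
    have epow : ∀ m : ℕ, z ⬝ᵥ ((γ ^ p) ^ m *ᵥ (γ ^ (p * j) *ᵥ θ)) = f (p * j + p * m) := by
      intro m
      rw [Matrix.mulVec_mulVec, ← pow_mul, ← pow_add, add_comm]
    have e1 : z ⬝ᵥ (γ ^ p *ᵥ (γ ^ (p * j) *ᵥ θ)) = f (p * (j + 1)) := by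
      have := epow 1
      rwa [pow_one, mul_one, ← Nat.mul_succ] at this
    obtain ⟨m₁, m₂, hlt, hle, hd₁, hd₂⟩ := hM (γ ^ p) z (γ ^ (p * j) *ᵥ θ) (e + 1)
      (by rw [Matrix.det_pow, hdet, one_pow]) (exists_one_add_smul_pow hB p)
      (by
        rw [e0]
        have : (p : ℤ) ^ (e + 2) ∣ (p : ℤ) ^ (e + 1) * (u + j * v) := by
          rw [pow_succ _ (e + 1)]; exact mul_dvd_mul_left _ hj
        simpa using dvd_add (hmul j) this)
      (by
        rw [e1]
        have h := (pow_dvd_pow (p : ℤ) (Nat.le_succ (e + 1))).trans (hmul (j + 1))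
        have := dvd_add h (Dvd.intro (u + ((j + 1 : ℕ) : ℤ) * v) rfl)
        simpa using this)
      (by
        rw [e1]
        intro h
        have h2 := dvd_sub h (hmul (j + 1))
        rw [sub_sub_cancel, pow_succ _ (e + 1)] at h2
        have h3 := (mul_dvd_mul_iff_left (pow_ne_zero (e + 1) hp0)).mp h2
        apply hpv
        have := dvd_sub h3 hj
        rwa [show u + ((j + 1 : ℕ) : ℤ) * v - (u + j * v) = v by push_cast; ring] at this)
    rw [epow] at hd₁ hd₂
    have hp1 := hp.pos
    refine ⟨p * j + p * m₁, p * j + p * m₂, ?_, ?_, ?_, ?_⟩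
    · have := Nat.mul_lt_mul_of_pos_left hlt hp1
      omega
    · exact Nat.add_le_add (Nat.mul_le_mul_left _ hjp.le) (Nat.mul_le_mul_left _ hle)
    · rwa [add_right_comm] at hd₁
    · rwa [add_right_comm] at hd₂

/-! ### Short forms and their `p`-adic orders -/

/-- Thue's lemma. -/
theorem exists_small_dotProduct_dvd (N : ℕ) (hN : 0 < N) (θ : Fin 2 → ℤ) :
    ∃ z : Fin 2 → ℤ, z ≠ 0 ∧ (N : ℤ) ∣ z ⬝ᵥ θ ∧ (|z 0| + |z 1|) ^ 2 ≤ 4 * (N : ℤ) := by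
  have : NeZero N := ⟨hN.ne'⟩
  set k := N.sqrt
  let g : Fin (k + 1) × Fin (k + 1) → ZMod N := fun x => (x.1 : ℕ) * (θ 0 : ZMod N) +
    (x.2 : ℕ) * (θ 1 : ZMod N)
  obtain ⟨x, y, hxy, hg⟩ := Fintype.exists_ne_map_eq_of_card_lt g (by
    rw [ZMod.card, Fintype.card_prod, Fintype.card_fin]; exact Nat.lt_succ_sqrt N)
  refine ⟨![(x.1 : ℕ) - (y.1 : ℕ), (x.2 : ℕ) - (y.2 : ℕ)], ?_, ?_, ?_⟩
  · intro h
    apply hxy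
    have h0 := congrFun h 0
    have h1 := congrFun h 1
    simp only [Matrix.cons_val_zero, Matrix.cons_val_one, Pi.zero_apply] at h0 h1
    ext <;> omega
  · rw [← ZMod.intCast_zmod_eq_zero_iff_dvd]
    simp only [dotProduct, Fin.sum_univ_two, Matrix.cons_val_zero, Matrix.cons_val_one]
    push_cast
    have : g x - g y = 0 := sub_eq_zero.mpr hg
    rw [← this]; simp only [g]; ring
  · have a1 := x.1.2; have a2 := x.2.2; have a3 := y.1.2; have a4 := y.2.2
    simp only [Matrix.cons_val_zero, Matrix.cons_val_one]
    have b1 : |((x.1 : ℕ) : ℤ) - (y.1 : ℕ)| ≤ k := by rw [abs_le]; omega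
    have b2 : |((x.2 : ℕ) : ℤ) - (y.2 : ℕ)| ≤ k := by rw [abs_le]; omega
    have hk : (k : ℤ) * k ≤ N := by exact_mod_cast Nat.sqrt_le N
    nlinarith [abs_nonneg (((x.1 : ℕ) : ℤ) - (y.1 : ℕ)), abs_nonneg (((x.2 : ℕ) : ℤ) - (y.2 : ℕ))]

/-- A nonzero integer vector is a power of `p` times a vector not divisible by `p`. -/
theorem exists_eq_pow_smul_primitive {p : ℕ} (hp : p.Prime) (z : Fin 2 → ℤ) (hz : z ≠ 0) :
    ∃ (b : ℕ) (y : Fin 2 → ℤ), z = ((p : ℤ) ^ b) • y ∧ ¬ ((p : ℤ) ∣ y 0 ∧ (p : ℤ) ∣ y 1) := by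
  suffices h : ∀ n : ℕ, ∀ z : Fin 2 → ℤ, z ≠ 0 → (z 0).natAbs + (z 1).natAbs ≤ n →
      ∃ (b : ℕ) (y : Fin 2 → ℤ), z = ((p : ℤ) ^ b) • y ∧ ¬ ((p : ℤ) ∣ y 0 ∧ (p : ℤ) ∣ y 1) from
    h _ z hz le_rfl
  intro n
  induction n with
  | zero =>
    intro z hz h
    exact absurd (by ext i; fin_cases i <;> simp <;> omega) hz
  | succ n ih =>
    intro z hz h
    by_cases hd : (p : ℤ) ∣ z 0 ∧ (p : ℤ) ∣ z 1
    · obtain ⟨⟨s, hs⟩, t, ht⟩ := hd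
      have hzz : z = (p : ℤ) • ![s, t] := by ext i; fin_cases i <;> simp [hs, ht]
      have hst : (![s, t] : Fin 2 → ℤ) ≠ 0 := by rintro h0; exact hz (by rw [hzz, h0, smul_zero])
      have hne : s.natAbs + t.natAbs ≠ 0 := fun h0 => hst (by
        ext i; fin_cases i <;> simp <;> omega)
      obtain ⟨b, y, hy, hy'⟩ := ih ![s, t] hst (by
        rw [hs, ht, Int.natAbs_mul, Int.natAbs_mul, Int.natAbs_natCast, ← mul_add] at h
        have := Nat.mul_le_mul_right (s.natAbs + t.natAbs) hp.two_le
        simp only [Matrix.cons_val_zero, Matrix.cons_val_one]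
        omega)
      exact ⟨b + 1, y, by rw [hzz, hy, smul_smul, pow_succ'], hy'⟩
    · exact ⟨0, z, by simp, hd⟩

/-- The determinant of two plane vectors. -/
def wedge (u v : Fin 2 → ℤ) : ℤ := u 0 * v 1 - u 1 * v 0

theorem wedge_eq_zero_of_dotProduct {z u v : Fin 2 → ℤ} (hz : z ≠ 0) (hu : z ⬝ᵥ u = 0)
    (hv : z ⬝ᵥ v = 0) : wedge u v = 0 := by
  simp only [dotProduct, Fin.sum_univ_two] at hu hv
  have h1 : z 0 * wedge u v = 0 := by
    unfold wedge; linear_combination v 1 * hu - u 1 * hv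
  have h2 : z 1 * wedge u v = 0 := by
    unfold wedge; linear_combination u 0 * hv - v 0 * hu
  by_contra h
  apply hz
  ext i
  fin_cases i
  · simpa [h] using h1
  · simpa [h] using h2

theorem pow_dvd_of_coprime_smul {N d : ℤ} {u : Fin 2 → ℤ} (hu : IsCoprime (u 0) (u 1))
    (h0 : N ∣ d * u 0) (h1 : N ∣ d * u 1) : N ∣ d := by
  obtain ⟨a, b, hab⟩ := hu
  have := dvd_add (h0.mul_left a) (h1.mul_left b)
  rwa [show a * (d * u 0) + b * (d * u 1) = d by linear_combination d * hab] at this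

/-- The exact `p`-adic order of a primitive form vanishing at `u`, evaluated at `v`. -/
theorem dotProduct_order {p : ℕ} (hp : p.Prime) {e : ℕ} {z u v : Fin 2 → ℤ}
    (hz : ¬ ((p : ℤ) ∣ z 0 ∧ (p : ℤ) ∣ z 1)) (hu : IsCoprime (u 0) (u 1))
    (he : (p : ℤ) ^ e ∣ wedge u v) (he' : ¬ (p : ℤ) ^ (e + 1) ∣ wedge u v)
    (hzu : (p : ℤ) ^ (e + 1) ∣ z ⬝ᵥ u) :
    (p : ℤ) ^ e ∣ z ⬝ᵥ v ∧ ¬ (p : ℤ) ^ (e + 1) ∣ z ⬝ᵥ v := by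
  have hzu' := (pow_dvd_pow (p : ℤ) (Nat.le_succ e)).trans hzu
  -- By `k0` and `k1`, `(z · v) u` is congruent to `wedge u v` times `(z 1, -z 0)` modulo `z · u`.
  -- Both `u` and `z` are primitive at `p`, so the two scalars have the same order.
  have k0 : (z ⬝ᵥ v) * u 0 = v 0 * (z ⬝ᵥ u) + z 1 * wedge u v := by
    simp only [dotProduct, Fin.sum_univ_two, wedge]; ring
  have k1 : (z ⬝ᵥ v) * u 1 = v 1 * (z ⬝ᵥ u) - z 0 * wedge u v := by
    simp only [dotProduct, Fin.sum_univ_two, wedge]; ring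
  have hp0 : (p : ℤ) ≠ 0 := by exact_mod_cast hp.ne_zero
  have hpZ : Prime (p : ℤ) := Nat.prime_iff_prime_int.mp hp
  refine ⟨pow_dvd_of_coprime_smul hu ?_ ?_, fun h => hz ?_⟩
  · rw [k0]; exact dvd_add (hzu'.mul_left _) (he.mul_left _)
  · rw [k1]; exact dvd_sub (hzu'.mul_left _) (he.mul_left _)
  · obtain ⟨d, hd⟩ := he
    have hpd : ¬ (p : ℤ) ∣ d := by
      rintro ⟨d', rfl⟩; exact he' ⟨d', by rw [hd]; ring⟩
    have aux : ∀ s : ℤ, (p : ℤ) ^ (e + 1) ∣ s * wedge u v → (p : ℤ) ∣ s := by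
      intro s hs
      rw [hd, show s * ((p : ℤ) ^ e * d) = (p : ℤ) ^ e * (s * d) by ring, pow_succ,
        mul_dvd_mul_iff_left (pow_ne_zero e hp0)] at hs
      exact (hpZ.dvd_or_dvd hs).resolve_right hpd
    constructor
    · apply aux
      have := dvd_sub (hzu.mul_left (v 1)) (h.mul_right (u 1))
      rwa [k1, sub_sub_cancel] at this
    · apply aux
      have := dvd_sub (h.mul_right (u 0)) (hzu.mul_left (v 0))
      rwa [k0, add_sub_cancel_left] at this

/-! ### Bad words and the absence of long periods -/

/-- Words of positive letters whose convergent denominators satisfy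
`c ≤ q |q|_p ‖q x‖`, expressed through integral forms in consecutive denominators. -/
structure BadWord (p : ℕ) (a : ℕ → ℕ) (c : ℝ) : Prop where
  pos : ∀ n, 1 ≤ a n
  c_pos : 0 < c
  bad : ∀ (n : ℕ) (z : Fin 2 → ℤ) (K : ℕ), z ⬝ᵥ denVec a n ≠ 0 →
    (p : ℤ) ^ K ∣ z ⬝ᵥ denVec a n → c * (p : ℝ) ^ K ≤ (|z 0| + |z 1| : ℤ) ^ 2

theorem isCoprime_denVec (a : ℕ → ℕ) (n : ℕ) : IsCoprime (denVec a n 0) (denVec a n 1) := by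
  induction n with
  | zero => rw [denVec_zero]; exact isCoprime_one_left
  | succ n ih =>
    rw [denVec_succ]
    simp only [Matrix.cons_val_zero, Matrix.cons_val_one]
    rw [add_comm]
    exact (ih.symm.add_mul_right_left _)

theorem denVec_bounds {a : ℕ → ℕ} (ha : ∀ n, 1 ≤ a n) (n : ℕ) :
    1 ≤ denVec a (n + 1) 1 ∧ denVec a (n + 1) 1 ≤ denVec a (n + 1) 0 := by
  induction n with
  | zero =>
    rw [denVec_succ, denVec_zero]
    have : (1 : ℤ) ≤ a 0 := by exact_mod_cast ha 0
    simpa using this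
  | succ n ih =>
    rw [denVec_succ a (n + 1)]
    have : (1 : ℤ) ≤ a (n + 1) := by exact_mod_cast ha (n + 1)
    simp only [Matrix.cons_val_zero, Matrix.cons_val_one]
    constructor <;> nlinarith

theorem denVec_lt_succ {a : ℕ → ℕ} (ha : ∀ n, 1 ≤ a n) (n : ℕ) :
    denVec a (n + 1) 0 < denVec a (n + 2) 0 := by
  have h := denVec_bounds ha n
  have : (1 : ℤ) ≤ a (n + 1) := by exact_mod_cast ha (n + 1)
  rw [denVec_succ a (n + 1)]
  simp only [Matrix.cons_val_zero]
  nlinarith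

theorem denVec_strictMono {a : ℕ → ℕ} (ha : ∀ n, 1 ≤ a n) :
    StrictMono fun n => denVec a (n + 1) 0 :=
  strictMono_nat_of_lt_succ (denVec_lt_succ ha)

/-- Proportional states with coprime entries would give `q_n ∣ q_m`, while `q_m < q_n`. -/
theorem wedge_denVec_ne_zero {a : ℕ → ℕ} (ha : ∀ n, 1 ≤ a n) {m n : ℕ} (hm : 1 ≤ m)
    (hmn : m < n) : wedge (denVec a m) (denVec a n) ≠ 0 := by
  obtain ⟨m, rfl⟩ := Nat.exists_eq_add_of_le' hm
  obtain ⟨n, rfl⟩ := Nat.exists_eq_add_of_le' (hm.trans hmn.le)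
  intro h
  have hlt := denVec_strictMono ha (show m < n by omega)
  simp only at hlt
  have hpos := denVec_bounds ha m
  have hdvd : denVec a (n + 1) 0 ∣ denVec a (m + 1) 0 := by
    refine (isCoprime_denVec a (n + 1)).dvd_of_dvd_mul_right
      (Dvd.intro (denVec a (m + 1) 1) ?_)
    unfold wedge at h; linarith
  have := Int.le_of_dvd (by linarith) hdvd
  linarith

/-- Thue's lemma is applied with `B` spare powers of `p`; badness shows that removing the content of
the form costs fewer than `B` of them. -/
theorem exists_primitive_form {p : ℕ} (hp : p.Prime) {a : ℕ → ℕ} {c : ℝ} (h : BadWord p a c)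
    {B : ℕ} (hB : 4 < c * (p : ℝ) ^ B) (n e : ℕ) :
    ∃ z : Fin 2 → ℤ, ¬ ((p : ℤ) ∣ z 0 ∧ (p : ℤ) ∣ z 1) ∧
      (p : ℤ) ^ (e + 1) ∣ z ⬝ᵥ denVec a n ∧
      (|z 0| + |z 1|) ^ 2 ≤ 4 * (p : ℤ) ^ (e + 1 + B) := by
  obtain ⟨z, hz0, hdvd, hz⟩ := exists_small_dotProduct_dvd (p ^ (e + 1 + B))
    (pow_pos hp.pos _) (denVec a n)
  push_cast at hdvd hz
  obtain ⟨b, y, rfl, hy⟩ := exists_eq_pow_smul_primitive hp z hz0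
  have hp0 : (0 : ℤ) < p := by exact_mod_cast hp.pos
  have hp1 : (1 : ℤ) ≤ p := hp0
  have hpb : (1 : ℤ) ≤ (p : ℤ) ^ b := one_le_pow₀ hp1
  have hnorm : (|((p : ℤ) ^ b • y) 0| + |((p : ℤ) ^ b • y) 1|) ^ 2 =
      ((p : ℤ) ^ b) ^ 2 * (|y 0| + |y 1|) ^ 2 := by
    simp only [Pi.smul_apply, smul_eq_mul, abs_mul, abs_of_pos (show (0 : ℤ) < (p : ℤ) ^ b by
      linarith)]
    ring
  rw [hnorm] at hz
  rw [smul_dotProduct, smul_eq_mul] at hdvd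
  have hle : (|y 0| + |y 1|) ^ 2 ≤ 4 * (p : ℤ) ^ (e + 1 + B) := by
    have := mul_le_mul_of_nonneg_right (one_le_pow₀ hpb : (1 : ℤ) ≤ ((p : ℤ) ^ b) ^ 2)
      (sq_nonneg (|y 0| + |y 1|))
    linarith
  refine ⟨y, hy, ?_, hle⟩
  by_cases h0 : y ⬝ᵥ denVec a n = 0
  · rw [h0]; exact dvd_zero _
  -- After division by `p^b` the squared size drops by `p^(2b)` and the divisibility only by `p^b`,
  -- so badness gives `c p^b ≤ 4`. The second alternative in `key` covers `b` beyond the whole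
  -- exponent.
  have hbB : b < B := by
    by_contra hcon
    push Not at hcon
    have hpR : (1 : ℝ) ≤ p := by exact_mod_cast hp1
    have hzR : ((p : ℝ) ^ b) ^ 2 * ((|y 0| + |y 1| : ℤ) : ℝ) ^ 2 ≤ 4 * (p : ℝ) ^ (e + 1 + B) := by
      exact_mod_cast hz
    have key : ∀ R : ℕ, (p : ℤ) ^ R ∣ y ⬝ᵥ denVec a n → b + R = e + 1 + B ∨ b ≥ e + 1 + B ∧ R = 0 →
        False := by
      intro R hR hRb
      have h1 := h.bad n y R h0 hR
      have h2 : (p : ℝ) ^ (e + 1 + B) ≤ (p : ℝ) ^ b * (p : ℝ) ^ R := by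
        rw [← pow_add]; exact pow_le_pow_right₀ hpR (by omega)
      have h3 : (p : ℝ) ^ B ≤ (p : ℝ) ^ b := pow_le_pow_right₀ hpR hcon
      have hb0 : (0 : ℝ) < (p : ℝ) ^ b := by positivity
      have hR0 : (0 : ℝ) < (p : ℝ) ^ R := by positivity
      have h4 : ((p : ℝ) ^ b) ^ 2 * (c * (p : ℝ) ^ R) ≤ 4 * ((p : ℝ) ^ b * (p : ℝ) ^ R) :=
        (mul_le_mul_of_nonneg_left h1 (by positivity)).trans (hzR.trans (by linarith))
      have h5 : 4 < c * (p : ℝ) ^ b := hB.trans_le (mul_le_mul_of_nonneg_left h3 h.c_pos.le)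
      have h6 : 4 * ((p : ℝ) ^ b * (p : ℝ) ^ R) < c * (p : ℝ) ^ b * ((p : ℝ) ^ b * (p : ℝ) ^ R) :=
        mul_lt_mul_of_pos_right h5 (by positivity)
      nlinarith
    by_cases hbe : b ≤ e + 1 + B
    · refine key (e + 1 + B - b) ?_ (Or.inl (by omega))
      rwa [show e + 1 + B = b + (e + 1 + B - b) by omega, pow_add,
        mul_dvd_mul_iff_left (by linarith : (p : ℤ) ^ b ≠ 0)] at hdvd
    · exact key 0 (by simp) (Or.inr ⟨by omega, rfl⟩)
  rw [show e + 1 + B = b + (e + 1 + (B - b)) by omega, pow_add,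
        mul_dvd_mul_iff_left (by linarith : (p : ℤ) ^ b ≠ 0)] at hdvd
  exact (pow_dvd_pow _ (by omega)).trans hdvd

/-- A unipotent-like matrix `γ` and a state `q` of a bad word yield a short form `z` that is
`p`-adically so small at some `γ ^ m q` that it has to vanish at every state congruent to it. -/
theorem BadWord.exists_form {p : ℕ} (hp : p.Prime) {a : ℕ → ℕ} {c : ℝ} (h : BadWord p a c) :
    ∃ K M B : ℕ, ∀ (n e : ℕ) (γ : Matrix (Fin 2) (Fin 2) ℤ), γ.det = 1 →
      (∃ X : Matrix (Fin 2) (Fin 2) ℤ, γ = 1 + ((p : ℤ) ^ 2) • X) →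
      (p : ℤ) ^ e ∣ wedge (denVec a n) (γ *ᵥ denVec a n) →
      ¬ (p : ℤ) ^ (e + 1) ∣ wedge (denVec a n) (γ *ᵥ denVec a n) →
      ∃ z : Fin 2 → ℤ, z ≠ 0 ∧ (|z 0| + |z 1|) ^ 2 ≤ 4 * (p : ℤ) ^ (e + B) ∧
        (∀ k, (p : ℤ) ^ (e + K) ∣ z ⬝ᵥ denVec a k → z ⬝ᵥ denVec a k = 0) ∧
        ∃ m₁ m₂, m₁ < m₂ ∧ m₂ ≤ M ∧ (p : ℤ) ^ (e + K) ∣ z ⬝ᵥ (γ ^ m₁ *ᵥ denVec a n) ∧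
          (p : ℤ) ^ (e + K) ∣ z ⬝ᵥ (γ ^ m₂ *ᵥ denVec a n) := by
  have hpR : (1 : ℝ) < p := by exact_mod_cast hp.one_lt
  have harch : ∀ y : ℝ, ∃ B : ℕ, y < c * (p : ℝ) ^ B := fun y => by
    obtain ⟨B, hB⟩ := pow_unbounded_of_one_lt (y / c) hpR
    exact ⟨B, by rwa [div_lt_iff₀' h.c_pos] at hB⟩
  obtain ⟨B, hB⟩ := harch 4
  -- With this `K`, a nonzero value divisible by `p^(e+K)` contradicts `|z|² ≤ 4 p^(e+1+B)`.
  obtain ⟨K, hK⟩ := harch (4 * (p : ℝ) ^ (1 + B))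
  obtain ⟨M, hM⟩ := exists_pow_dvd_dotProduct_pow hp K
  refine ⟨K, M, 1 + B, fun n e γ hdet hX he he' => ?_⟩
  obtain ⟨z, hz, hdvd, hsize⟩ := exists_primitive_form hp h hB n e
  obtain ⟨o1, o2⟩ := dotProduct_order hp hz (isCoprime_denVec a n) he he' hdvd
  refine ⟨z, ?_, by rwa [← add_assoc], fun k hk => ?_, hM γ z _ e hdet hX hdvd o1 o2⟩
  · rintro rfl; exact hz (by simp)
  · by_contra h0
    have h1 := h.bad k z _ h0 hk
    have h2 : ((|z 0| + |z 1| : ℤ) : ℝ) ^ 2 ≤ 4 * (p : ℝ) ^ (e + 1 + B) := by exact_mod_cast hsize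
    rw [add_assoc, pow_add] at h2
    rw [pow_add] at h1
    have h3 : (0 : ℝ) < (p : ℝ) ^ e := by positivity
    nlinarith

theorem exists_pow_eq_one_add {N : ℕ} (hN : 0 < N) :
    ∃ M : ℕ, 0 < M ∧ ∀ X : Matrix (Fin 2) (Fin 2) ℤ, X.det ^ 2 = 1 →
      (X ^ (2 * M)).det = 1 ∧ ∃ Y : Matrix (Fin 2) (Fin 2) ℤ, X ^ (2 * M) = 1 + (N : ℤ) • Y := by
  have : NeZero N := ⟨hN.ne'⟩
  -- The order of `GL₂(ℤ/N)` gives the congruence; doubling it makes the determinant `1` rather than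
  -- `±1`.
  refine ⟨Fintype.card (Matrix (Fin 2) (Fin 2) (ZMod N))ˣ, Fintype.card_pos, fun X hX => ⟨?_, ?_⟩⟩
  · rw [Matrix.det_pow, pow_mul, hX, one_pow]
  · set M := Fintype.card (Matrix (Fin 2) (Fin 2) (ZMod N))ˣ
    let φ := (Int.castRingHom (ZMod N)).mapMatrix (m := Fin 2)
    have hunit : IsUnit X := by
      rw [Matrix.isUnit_iff_isUnit_det]
      exact IsUnit.of_mul_eq_one _ (by rw [← pow_two]; exact hX)
    obtain ⟨u, hu⟩ := hunit.map φ
    have h1 : φ (X ^ (2 * M)) = 1 := by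
      rw [map_pow, ← hu, mul_comm, pow_mul, ← Units.val_pow_eq_pow_val, pow_card_eq_one]
      simp
    have h2 : ∀ i j, ∃ y : ℤ, (X ^ (2 * M)) i j - (1 : Matrix (Fin 2) (Fin 2) ℤ) i j = N * y := by
      intro i j
      apply (ZMod.intCast_zmod_eq_zero_iff_dvd _ N).mp
      have h3 := congrFun (congrFun (h1.trans (map_one φ).symm) i) j
      simp only [φ, RingHom.mapMatrix_apply, Matrix.map_apply, eq_intCast] at h3
      rw [Int.cast_sub, h3, sub_self]
    choose Y hY using h2
    refine ⟨Matrix.of Y, ?_⟩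
    ext i j
    rw [Matrix.add_apply, Matrix.smul_apply, Matrix.of_apply, smul_eq_mul, ← hY]; ring

theorem exists_exact_pow {p : ℕ} (hp : p.Prime) {d : ℤ} (hd : d ≠ 0) :
    ∃ e : ℕ, (p : ℤ) ^ e ∣ d ∧ ¬ (p : ℤ) ^ (e + 1) ∣ d := by
  have hf : FiniteMultiplicity (p : ℤ) d := by
    rw [Int.finiteMultiplicity_iff]
    exact ⟨by simpa using hp.one_lt.ne', hd⟩
  exact ⟨multiplicity (p : ℤ) d, pow_multiplicity_dvd _ _,
    hf.not_pow_dvd_of_multiplicity_lt (Nat.lt_succ_self _)⟩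

/-- A bad word contains no long stretch of a given period. -/
theorem BadWord.not_periodic {p : ℕ} (hp : p.Prime) {a : ℕ → ℕ} {c : ℝ} (h : BadWord p a c)
    {d : ℕ} (hd : 1 ≤ d) :
    ∃ L : ℕ, ∀ n, 1 ≤ n → ¬ ∀ i < L, a (n + i + d) = a (n + i) := by
  obtain ⟨K, M, B, hkey⟩ := h.exists_form hp
  obtain ⟨m₀, hm₀, hpow⟩ := exists_pow_eq_one_add (pow_pos hp.pos 2)
  refine ⟨d * (2 * m₀ * (M + 1)), fun n hn hper => ?_⟩
  have hblock : ∀ k ≤ 2 * m₀ * (M + 1), ∀ i < d, a (n + d * k + i) = a (n + i) := by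
    intro k
    induction k with
    | zero => intro _ i _; rfl
    | succ k ih =>
      intro hk i hi
      rw [← ih (by omega) i hi]
      have := hper (d * k + i) (by
        calc d * k + i < d * (k + 1) := by rw [mul_add, mul_one]; omega
          _ ≤ _ := Nat.mul_le_mul_left _ hk)
      rw [show n + d * (k + 1) + i = n + (d * k + i) + d by ring, this, add_assoc]
  set A := blockMat a n d
  have hstate : ∀ k ≤ 2 * m₀ * (M + 1), denVec a (n + d * k) = A ^ k *ᵥ denVec a n := by
    intro k
    induction k with
    | zero => intro _; simp
    | succ k ih =>
      intro hk
      rw [mul_add, mul_one, ← add_assoc, denVec_add, ih (by omega), Matrix.mulVec_mulVec, pow_succ',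
        blockMat_congr (hblock k (by omega))]
  set γ := A ^ (2 * m₀)
  have hγ : ∀ m ≤ M + 1, denVec a (n + d * (2 * m₀ * m)) = γ ^ m *ᵥ denVec a n := by
    intro m hm
    rw [hstate _ (Nat.mul_le_mul_left _ hm), pow_mul]
  obtain ⟨hdet, X, hX⟩ := hpow A (det_blockMat_sq a n d)
  push_cast at hX
  have hpos : ∀ m m', m < m' → n + d * (2 * m₀ * m) < n + d * (2 * m₀ * m') := by
    intro m m' hmm
    have : d * (2 * m₀ * m) < d * (2 * m₀ * m') :=
      Nat.mul_lt_mul_of_pos_left (Nat.mul_lt_mul_of_pos_left hmm (by omega)) hd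
    omega
  have hw : wedge (denVec a n) (γ *ᵥ denVec a n) ≠ 0 := by
    have h1 := hγ 1 (by omega)
    rw [pow_one] at h1
    rw [← h1]
    exact wedge_denVec_ne_zero h.pos hn (by simpa using hpos 0 1 (by norm_num))
  obtain ⟨e, he, he'⟩ := exists_exact_pow hp hw
  -- By `hγ` the vectors `γ ^ m₁ θ` and `γ ^ m₂ θ` are genuine states, so `z` vanishes at two
  -- non-proportional vectors.
  obtain ⟨z, hz, -, hzero, m₁, m₂, hlt, hle, hd₁, hd₂⟩ := hkey n e γ hdet ⟨X, hX⟩ he he'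
  rw [← hγ _ (by omega)] at hd₁ hd₂
  exact wedge_denVec_ne_zero h.pos (by omega) (hpos _ _ hlt)
    (wedge_eq_zero_of_dotProduct hz (hzero _ hd₁) (hzero _ hd₂))

/-! ### Complexity and right special factors -/

/-- Long stretches of any given period do not occur in `w`. -/
def NoLongPeriod (w : ℕ → ℕ) : Prop :=
  ∀ d, 1 ≤ d → ∃ L : ℕ, ∀ n, ¬ ∀ i < L, w (n + i + d) = w (n + i)

/-- The blocks of length `n` starting at `i` and at `j` coincide. -/
def Agree (w : ℕ → ℕ) (n i j : ℕ) : Prop := ∀ k < n, w (i + k) = w (j + k)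

theorem Agree.symm {w : ℕ → ℕ} {n i j : ℕ} (h : Agree w n i j) : Agree w n j i :=
  fun k hk => (h k hk).symm

theorem Agree.trans {w : ℕ → ℕ} {n i j l : ℕ} (h : Agree w n i j) (h' : Agree w n j l) :
    Agree w n i l := fun k hk => (h k hk).trans (h' k hk)

theorem Agree.mono {w : ℕ → ℕ} {n m i j : ℕ} (h : Agree w n i j) (hm : m ≤ n) :
    Agree w m i j := fun k hk => h k (by omega)

theorem agree_succ {w : ℕ → ℕ} {n i j : ℕ} :
    Agree w (n + 1) i j ↔ Agree w n i j ∧ w (i + n) = w (j + n) :=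
  ⟨fun h => ⟨h.mono (Nat.le_succ n), h n (Nat.lt_succ_self n)⟩, fun h k hk => by
    rcases Nat.lt_succ_iff_lt_or_eq.mp hk with hk | rfl
    exacts [h.1 k hk, h.2]⟩

theorem Agree.tail {w : ℕ → ℕ} {n i j : ℕ} (h : Agree w (n + 1) i j) :
    Agree w n (i + 1) (j + 1) := fun k hk => by
  have := h (k + 1) (by omega)
  rwa [show i + 1 + k = i + (k + 1) by ring, show j + 1 + k = j + (k + 1) by ring]

theorem agree_iff_factor_eq {w : ℕ → ℕ} {n i j : ℕ} :
    Agree w n i j ↔ (fun k : Fin n => w (i + k)) = fun k : Fin n => w (j + k) :=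
  ⟨fun h => funext fun k => h k k.2, fun h k hk => congrFun h ⟨k, hk⟩⟩

/-- If late windows of length `N` determined the next letter, two equal windows over the finite
alphabet would make the word eventually periodic. -/
theorem NoLongPeriod.not_deterministic {w : ℕ → ℕ} (hw : NoLongPeriod w) {D : ℕ}
    (hD : ∀ n, w n ≤ D) (N m : ℕ) :
    ∃ i j, m ≤ i ∧ m ≤ j ∧ Agree w N i j ∧ w (i + N) ≠ w (j + N) := by
  by_contra hcon
  push Not at hcon
  let g : ℕ → Fin N → Fin (D + 1) := fun i k => ⟨w (m + i + k), Nat.lt_succ_of_le (hD _)⟩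
  obtain ⟨i, j, hij, hg⟩ := Finite.exists_ne_map_eq_of_infinite g
  wlog hlt : i < j generalizing i j
  · exact this j i hij.symm hg.symm (by omega)
  have hall : ∀ k, Agree w N (m + i + k) (m + j + k) := by
    intro k
    induction k with
    | zero => exact fun l hl => congrArg Fin.val (congrFun hg ⟨l, hl⟩)
    | succ k ih =>
      exact (agree_succ.mpr ⟨ih, hcon _ _ (by omega) (by omega) ih⟩).tail
  have heq : ∀ k, w (m + i + N + k) = w (m + j + N + k) := by
    intro k
    have := hcon _ _ (by omega) (by omega) (hall k)
    rwa [add_right_comm _ k, add_right_comm _ k] at this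
  obtain ⟨L, hL⟩ := hw (j - i) (by omega)
  refine hL (m + i + N) fun k _ => ?_
  rw [heq k]
  congr 1; omega

theorem factors_finite {w : ℕ → ℕ} {D : ℕ} (hD : ∀ n, w n ≤ D) (n : ℕ) : (factors w n).Finite := by
  refine (Set.Finite.pi' fun _ : Fin n => Set.finite_Iic D).subset ?_
  rintro _ ⟨i, rfl⟩ k
  exact hD _

theorem image_factors_succ (w : ℕ → ℕ) (n : ℕ) :
    (fun (u : Fin (n + 1) → ℕ) (k : Fin n) => u k.castSucc) '' factors w (n + 1) = factors w n := by
  ext u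
  constructor
  · rintro ⟨_, ⟨i, rfl⟩, rfl⟩; exact ⟨i, rfl⟩
  · rintro ⟨i, rfl⟩; exact ⟨_, ⟨i, rfl⟩, rfl⟩

/-- Morse–Hedlund: deleting the last letter maps factors onto factors, and injectivity would mean
determinism. -/
theorem NoLongPeriod.complexity_lt_succ {w : ℕ → ℕ} (hw : NoLongPeriod w) {D : ℕ}
    (hD : ∀ n, w n ≤ D) (n : ℕ) : complexity w n < complexity w (n + 1) := by
  by_contra hcon
  push Not at hcon
  have hfin := factors_finite hD (n + 1)
  have hinj := Set.injOn_of_ncard_image_eq (f := fun (u : Fin (n + 1) → ℕ) (k : Fin n) =>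
    u k.castSucc) (s := factors w (n + 1)) (by
      apply le_antisymm (Set.ncard_image_le hfin)
      rw [image_factors_succ]; exact hcon) hfin
  obtain ⟨i, j, -, -, hag, hne⟩ := hw.not_deterministic hD n 0
  apply hne
  have := hinj ⟨i, rfl⟩ ⟨j, rfl⟩ (agree_iff_factor_eq.mp hag)
  exact congrFun this (Fin.last n)

theorem exists_unique_collision {α β : Type*} {f : α → β} {S : Set α} (hS : S.Finite)
    (hcard : S.ncard = (f '' S).ncard + 1) :
    ∃ x ∈ S, ∃ y ∈ S, x ≠ y ∧ f x = f y ∧ ∀ x' ∈ S, ∀ y' ∈ S, f x' = f y' → x' ≠ y' →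
      (x' = x ∧ y' = y) ∨ (x' = y ∧ y' = x) := by
  obtain ⟨x, hx, y, hy, hne, hxy⟩ : ∃ x ∈ S, ∃ y ∈ S, x ≠ y ∧ f x = f y := by
    by_contra hcon
    push Not at hcon
    have : Set.InjOn f S := fun x hx y hy hxy => by
      by_contra hne; exact hcon x hx y hy hne hxy
    rw [this.ncard_image] at hcard
    omega
  have himg : f '' (S \ {x}) = f '' S := by
    apply (Set.image_mono Set.sdiff_subset).antisymm
    rintro _ ⟨u, hu, rfl⟩
    by_cases hux : u = x
    · exact ⟨y, ⟨hy, hne.symm⟩, by rw [hux, hxy]⟩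
    · exact ⟨u, ⟨hu, hux⟩, rfl⟩
  have hinj : Set.InjOn f (S \ {x}) := by
    apply Set.injOn_of_ncard_image_eq _ (hS.subset Set.sdiff_subset)
    rw [himg, Set.ncard_sdiff_singleton_of_mem hx, hcard, Nat.add_sub_cancel]
  refine ⟨x, hx, y, hy, hne, hxy, fun x' hx' y' hy' hf hne' => ?_⟩
  by_cases h1 : x' = x
  · subst h1
    exact Or.inl ⟨rfl, hinj ⟨hy', hne'.symm⟩ ⟨hy, hne.symm⟩ (hf.symm.trans hxy)⟩
  · by_cases h2 : y' = x
    · subst h2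
      exact Or.inr ⟨hinj ⟨hx', h1⟩ ⟨hy, hne.symm⟩ (hf.trans hxy), rfl⟩
    · exact absurd (hinj ⟨hx', h1⟩ ⟨hy', h2⟩ hf) hne'

/-- The common block at `i` and `j` is the unique right special factor of length `n`; exactly two
letters can follow it. -/
theorem exists_special_pair {w : ℕ → ℕ} {D : ℕ} (hD : ∀ n, w n ≤ D) {n : ℕ}
    (hn : complexity w (n + 1) = complexity w n + 1) :
    ∃ i j, Agree w n i j ∧ w (i + n) ≠ w (j + n) ∧ ∀ i' j', Agree w n i' j' →
      w (i' + n) ≠ w (j' + n) → (Agree w (n + 1) i' i ∧ Agree w (n + 1) j' j) ∨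
        (Agree w (n + 1) i' j ∧ Agree w (n + 1) j' i) := by
  obtain ⟨_, ⟨i, rfl⟩, _, ⟨j, rfl⟩, hne, heq, huniq⟩ := exists_unique_collision
    (f := fun (u : Fin (n + 1) → ℕ) (k : Fin n) => u k.castSucc) (factors_finite hD (n + 1))
    (by rw [image_factors_succ]; exact hn)
  have hag : Agree w n i j := agree_iff_factor_eq.mpr heq
  refine ⟨i, j, hag, fun h => hne (agree_iff_factor_eq.mp (agree_succ.mpr ⟨hag, h⟩)),
    fun i' j' hag' hne' => ?_⟩
  simp only [agree_iff_factor_eq]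
  exact huniq _ ⟨i', rfl⟩ _ ⟨j', rfl⟩ (agree_iff_factor_eq.mp hag')
    fun h => hne' (agree_succ.mp (agree_iff_factor_eq.mpr h)).2

/-- The prefix of `w` of length `i` ends with the first `N` letters of the left-infinite word
`… ρ 1 ρ 0`. -/
def Occ (w ρ : ℕ → ℕ) (N i : ℕ) : Prop := N ≤ i ∧ ∀ k < N, w (i - 1 - k) = ρ k

/-- The blocks of length `N` ending before `i` and before `j` coincide. -/
def AgreeLeft (w : ℕ → ℕ) (N i j : ℕ) : Prop := N ≤ i ∧ N ≤ j ∧ Agree w N (i - N) (j - N)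

theorem Occ.agreeLeft {w ρ : ℕ → ℕ} {N i j : ℕ} (hi : Occ w ρ N i) (hj : Occ w ρ N j) :
    AgreeLeft w N i j := by
  refine ⟨hi.1, hj.1, fun k hk => ?_⟩
  have h1 := hi.2 (N - 1 - k) (by omega)
  have h2 := hj.2 (N - 1 - k) (by omega)
  have := hi.1
  have := hj.1
  rw [show i - N + k = i - 1 - (N - 1 - k) by omega, h1, ← h2]
  congr 1; omega

theorem Occ.of_agreeLeft {w ρ : ℕ → ℕ} {N i j : ℕ} (hi : Occ w ρ N i) (h : AgreeLeft w N j i) :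
    Occ w ρ N j := by
  obtain ⟨h1, h2, h3⟩ := h
  refine ⟨h1, fun k hk => ?_⟩
  have := h3 (N - 1 - k) (by omega)
  rw [← hi.2 k hk, show j - 1 - k = j - N + (N - 1 - k) by omega, this]
  congr 1; omega

/-- The structure of words of complexity `n + const`: for each `N ≥ n₀` there is a single right
special factor of length `N`, it is the suffix of one left-infinite word `ρ`, and it is followed
by the letters `a` and `b`. -/
structure SpecialWord (w ρ : ℕ → ℕ) (n₀ a b : ℕ) : Prop where
  ne : a ≠ b
  exists_left : ∀ N, n₀ ≤ N → ∃ i, Occ w ρ N i ∧ w i = a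
  exists_right : ∀ N, n₀ ≤ N → ∃ i, Occ w ρ N i ∧ w i = b
  special : ∀ N, n₀ ≤ N → ∀ i j, AgreeLeft w N i j → w i ≠ w j →
    Occ w ρ N i ∧ (w i = a ∨ w i = b)

theorem SpecialWord.symm {w ρ : ℕ → ℕ} {n₀ a b : ℕ} (h : SpecialWord w ρ n₀ a b) :
    SpecialWord w ρ n₀ b a :=
  ⟨h.ne.symm, h.exists_right, h.exists_left, fun N hN i j hij hne =>
    ⟨(h.special N hN i j hij hne).1, (h.special N hN i j hij hne).2.symm⟩⟩

/-- Deleting the first letter of the special factor of length `N + 1` leaves a special factor, hence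
the one of length `N`. So the special factors are nested suffixes and their two continuations never
change. The representatives `I`, `J` may swap roles, hence the alternatives in `hstep` and
`hletters`. -/
theorem exists_specialWord {w : ℕ → ℕ} {D : ℕ} (hD : ∀ n, w n ≤ D) {n₀ : ℕ}
    (hn : ∀ n, n₀ ≤ n → complexity w (n + 1) = complexity w n + 1) :
    ∃ ρ a b, SpecialWord w ρ n₀ a b := by
  have h := fun n => fun hn' : n₀ ≤ n => exists_special_pair hD (hn n hn')
  choose! I J hag hne huniq using h
  have hstep : ∀ N, n₀ ≤ N →
      (Agree w (N + 1) (I (N + 1) + 1) (I N) ∧ Agree w (N + 1) (J (N + 1) + 1) (J N)) ∨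
      (Agree w (N + 1) (I (N + 1) + 1) (J N) ∧ Agree w (N + 1) (J (N + 1) + 1) (I N)) := by
    intro N hN
    apply huniq N hN _ _ (hag (N + 1) (by omega)).tail
    have := hne (N + 1) (by omega)
    rwa [add_right_comm, add_right_comm (J (N + 1)), add_assoc, add_assoc (J (N + 1))]
  have hIstep : ∀ N, n₀ ≤ N → Agree w N (I (N + 1) + 1) (I N) := by
    intro N hN
    rcases hstep N hN with ⟨h1, -⟩ | ⟨h1, -⟩
    · exact h1.mono (Nat.le_succ N)
    · exact (h1.mono (Nat.le_succ N)).trans (hag N hN).symm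
  have hletters : ∀ N, n₀ ≤ N →
      (w (I N + N) = w (I n₀ + n₀) ∧ w (J N + N) = w (J n₀ + n₀)) ∨
      (w (I N + N) = w (J n₀ + n₀) ∧ w (J N + N) = w (I n₀ + n₀)) := by
    intro N hN
    induction N, hN using Nat.le_induction with
    | base => exact Or.inl ⟨rfl, rfl⟩
    | succ N hN ih =>
      have e1 : ∀ x, x + (N + 1) = x + 1 + N := fun x => by omega
      rw [e1, e1]
      rcases hstep N hN with ⟨h1, h2⟩ | ⟨h1, h2⟩ <;>
      · rw [h1 N (Nat.lt_succ_self N), h2 N (Nat.lt_succ_self N)]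
        tauto
  let ρ : ℕ → ℕ := fun k => w (I (max n₀ (k + 1)) + (max n₀ (k + 1) - 1 - k))
  have hρ : ∀ k N, max n₀ (k + 1) ≤ N → w (I N + (N - 1 - k)) = ρ k := by
    intro k N hN
    induction N, hN using Nat.le_induction with
    | base => rfl
    | succ N hN ih =>
      rw [← ih, show I (N + 1) + (N + 1 - 1 - k) = I (N + 1) + 1 + (N - 1 - k) by omega]
      exact hIstep N (by omega) _ (by omega)
  have hoccI : ∀ N, n₀ ≤ N → Occ w ρ N (I N + N) := fun N hN => ⟨by omega, fun k hk => by
    rw [← hρ k N (by omega)]; congr 1; omega⟩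
  have hoccJ : ∀ N, n₀ ≤ N → Occ w ρ N (J N + N) := fun N hN => (hoccI N hN).of_agreeLeft
    ⟨by omega, by omega, by simpa using (hag N hN).symm⟩
  refine ⟨ρ, w (I n₀ + n₀), w (J n₀ + n₀), hne n₀ le_rfl, fun N hN => ?_, fun N hN => ?_,
    fun N hN i j hij hij' => ?_⟩
  · rcases hletters N hN with h | h
    exacts [⟨_, hoccI N hN, h.1⟩, ⟨_, hoccJ N hN, h.2⟩]
  · rcases hletters N hN with h | h
    exacts [⟨_, hoccJ N hN, h.2⟩, ⟨_, hoccI N hN, h.1⟩]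
  · obtain ⟨hi, hj, hagr⟩ := hij
    have key : ∀ x, x = I N ∨ x = J N → Agree w (N + 1) (i - N) x →
        Occ w ρ N i ∧ (w i = w (I n₀ + n₀) ∨ w i = w (J n₀ + n₀)) := by
      intro x hx hagx
      have hlast := hagx N (Nat.lt_succ_self N)
      rw [Nat.sub_add_cancel hi] at hlast
      have hocc : Occ w ρ N (x + N) := by
        rcases hx with rfl | rfl
        exacts [hoccI N hN, hoccJ N hN]
      refine ⟨hocc.of_agreeLeft ⟨hi, by omega, by simpa using hagx.mono (Nat.le_succ N)⟩, ?_⟩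
      rw [hlast]
      rcases hx with rfl | rfl <;> rcases hletters N hN with h | h <;> simp [h.1, h.2]
    rcases huniq N hN (i - N) (j - N) hagr (by
      rwa [Nat.sub_add_cancel hi, Nat.sub_add_cancel hj]) with h | h
    · exact key _ (Or.inl rfl) h.1
    · exact key _ (Or.inr rfl) h.1

/-- A nondecreasing integer sequence is unbounded or eventually constant. -/
theorem exists_complexity_succ {w : ℕ → ℕ} (hw : NoLongPeriod w) {D : ℕ} (hD : ∀ n, w n ≤ D)
    (h : ¬ Tendsto (fun n : ℕ => (complexity w n : ℤ) - (n : ℤ)) atTop atTop) :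
    ∃ n₀, ∀ n, n₀ ≤ n → complexity w (n + 1) = complexity w n + 1 := by
  have hmono : Monotone fun n : ℕ => (complexity w n : ℤ) - (n : ℤ) :=
    monotone_nat_of_le_succ fun n => by
      have := hw.complexity_lt_succ hD n
      push_cast; omega
  obtain ⟨l, hl⟩ := (tendsto_atTop_of_monotone hmono).resolve_left h
  rw [nhds_discrete, tendsto_pure, eventually_atTop] at hl
  obtain ⟨n₀, hn₀⟩ := hl
  refine ⟨n₀, fun n hn => ?_⟩
  have h1 := hn₀ n hn
  have h2 := hn₀ (n + 1) (by omega)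
  push_cast at h2
  omega

/-! ### Return words of the special factors -/

theorem AgreeLeft.mono {w : ℕ → ℕ} {N M i j : ℕ} (h : AgreeLeft w M i j) (hN : N ≤ M) :
    AgreeLeft w N i j := by
  obtain ⟨h1, h2, h3⟩ := h
  refine ⟨by omega, by omega, fun k hk => ?_⟩
  have := h3 (M - N + k) (by omega)
  rwa [show i - N + k = i - M + (M - N + k) by omega, show j - N + k = j - M + (M - N + k) by omega]

theorem AgreeLeft.extend {w : ℕ → ℕ} {N i j d : ℕ} (h : AgreeLeft w N i j) (h' : Agree w d i j) :
    AgreeLeft w (N + d) (i + d) (j + d) := by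
  obtain ⟨h1, h2, h3⟩ := h
  refine ⟨by omega, by omega, fun k hk => ?_⟩
  rw [show i + d - (N + d) = i - N by omega, show j + d - (N + d) = j - N by omega]
  by_cases hkN : k < N
  · exact h3 k hkN
  · rw [show i - N + k = i + (k - N) by omega, show j - N + k = j + (k - N) by omega]
    exact h' _ (by omega)

theorem AgreeLeft.symm {w : ℕ → ℕ} {N i j : ℕ} (h : AgreeLeft w N i j) : AgreeLeft w N j i :=
  ⟨h.2.1, h.1, h.2.2.symm⟩

theorem Occ.of_succ {w ρ : ℕ → ℕ} {N i : ℕ} (h : Occ w ρ (N + 1) i) : Occ w ρ N i :=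
  ⟨(Nat.le_succ N).trans h.1, fun k hk => h.2 k (by omega)⟩

/-- After each occurrence of the factor of length `N` followed by the letter `c`, the next
occurrence comes after a fixed word of length `d` and block matrix `g`. -/
structure IsReturn (w ρ : ℕ → ℕ) (N c d : ℕ) (g : Matrix (Fin 2) (Fin 2) ℤ) : Prop where
  pos : 1 ≤ d
  occ : ∀ i, Occ w ρ N i → w i = c → Occ w ρ N (i + d)
  not_occ : ∀ i, Occ w ρ N i → w i = c → ∀ k, 0 < k → k < d → ¬ Occ w ρ N (i + k)
  agree : ∀ i j, Occ w ρ N i → w i = c → Occ w ρ N j → w j = c → Agree w d i j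
  mat : ∀ i, Occ w ρ N i → w i = c → blockMat w i d = g

namespace SpecialWord

variable {w ρ : ℕ → ℕ} {n₀ a b : ℕ}

theorem letter (h : SpecialWord w ρ n₀ a b) {N i : ℕ} (hN : n₀ ≤ N) (hi : Occ w ρ N i) :
    w i = a ∨ w i = b := by
  obtain ⟨j, hj, hja⟩ := h.exists_left N hN
  by_cases hij : w i = w j
  · exact Or.inl (hij.trans hja)
  · exact (h.special N hN i j (hi.agreeLeft hj) hij).2

theorem exists_occ_ge (h : SpecialWord w ρ n₀ a b) (hw : NoLongPeriod w) {D : ℕ}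
    (hD : ∀ n, w n ≤ D) {N : ℕ} (hN : n₀ ≤ N) (m : ℕ) : ∃ i, m ≤ i ∧ Occ w ρ N i := by
  obtain ⟨i, j, hi, -, hag, hne⟩ := hw.not_deterministic hD N m
  exact ⟨i + N, by omega, (h.special N hN (i + N) (j + N)
    ⟨by omega, by omega, by simpa using hag⟩ hne).1⟩

/-- Between two occurrences of the special factor no window of length `N` is special, so each next
letter is forced and the first letter determines the whole return. -/
theorem exists_isReturn (h : SpecialWord w ρ n₀ a b) (hw : NoLongPeriod w) {D : ℕ}
    (hD : ∀ n, w n ≤ D) {N : ℕ} (hN : n₀ ≤ N) : ∃ d g, IsReturn w ρ N a d g := by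
  classical
  obtain ⟨i₀, hi₀, hia⟩ := h.exists_left N hN
  have hex : ∃ d, 1 ≤ d ∧ Occ w ρ N (i₀ + d) := by
    obtain ⟨i, hi, hocc⟩ := h.exists_occ_ge hw hD hN (i₀ + 1)
    exact ⟨i - i₀, by omega, by rwa [Nat.add_sub_cancel' (by omega)]⟩
  set d := Nat.find hex
  obtain ⟨hd, hdocc⟩ := Nat.find_spec hex
  have hnot : ∀ k, 0 < k → k < d → ¬ Occ w ρ N (i₀ + k) := fun k hk hkd hocc =>
    Nat.find_min hex hkd ⟨hk, hocc⟩
  have hagree : ∀ i, Occ w ρ N i → w i = a → ∀ k ≤ d, Agree w k i i₀ := by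
    intro i hi hwi k
    induction k with
    | zero => intro _ k hk; omega
    | succ k ih =>
      intro hk
      refine agree_succ.mpr ⟨ih (by omega), ?_⟩
      rcases Nat.eq_zero_or_pos k with rfl | hk0
      · exact hwi.trans hia.symm
      · by_contra hne
        have hal := (((hi.agreeLeft hi₀).extend (ih (by omega))).mono (Nat.le_add_right N k)).symm
        exact hnot k hk0 (by omega) (h.special N hN _ _ hal (Ne.symm hne)).1
  have hleft : ∀ i, Occ w ρ N i → w i = a → ∀ k ≤ d, AgreeLeft w N (i + k) (i₀ + k) :=
    fun i hi hwi k hk =>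
      ((hi.agreeLeft hi₀).extend (hagree i hi hwi k hk)).mono (Nat.le_add_right N k)
  refine ⟨d, blockMat w i₀ d, hd, fun i hi hwi => hdocc.of_agreeLeft (hleft i hi hwi d le_rfl),
    fun i hi hwi k hk hkd hocc => hnot k hk hkd (hocc.of_agreeLeft (hleft i hi hwi k hkd.le).symm),
    fun i j hi hwi hj hwj => (hagree i hi hwi d le_rfl).trans (hagree j hj hwj d le_rfl).symm,
    fun i hi hwi => blockMat_congr (hagree i hi hwi d le_rfl)⟩

end SpecialWord

theorem IsReturn.unique {w ρ : ℕ → ℕ} {N c d d' i : ℕ} {g g' : Matrix (Fin 2) (Fin 2) ℤ}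
    (h : IsReturn w ρ N c d g) (h' : IsReturn w ρ N c d' g') (hi : Occ w ρ N i) (hc : w i = c) :
    d = d' ∧ g = g' := by
  have hd : d = d' := by
    rcases lt_trichotomy d d' with hlt | heq | hlt
    · exact absurd (h.occ i hi hc) (h'.not_occ i hi hc d h.pos hlt)
    · exact heq
    · exact absurd (h'.occ i hi hc) (h.not_occ i hi hc d' h'.pos hlt)
  subst hd
  exact ⟨rfl, (h.mat i hi hc).symm.trans (h'.mat i hi hc)⟩

theorem IsReturn.occ_succ_iff {w ρ : ℕ → ℕ} {N c d i j : ℕ} {g : Matrix (Fin 2) (Fin 2) ℤ}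
    (h : IsReturn w ρ N c d g) (hi : Occ w ρ N i) (hic : w i = c) (hj : Occ w ρ N j)
    (hjc : w j = c) (hocc : Occ w ρ (N + 1) (i + d)) : Occ w ρ (N + 1) (j + d) :=
  hocc.of_agreeLeft (((hj.agreeLeft hi).extend (h.agree j i hj hjc hi hic)).mono
    (by have := h.pos; omega))

theorem IsReturn.succ_of_occ {w ρ : ℕ → ℕ} {N c d : ℕ} {g : Matrix (Fin 2) (Fin 2) ℤ}
    (h : IsReturn w ρ N c d g) (hocc : ∀ i, Occ w ρ N i → w i = c → Occ w ρ (N + 1) (i + d)) :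
    IsReturn w ρ (N + 1) c d g :=
  ⟨h.pos, fun i hi hc => hocc i hi.of_succ hc,
    fun i hi hc k hk hkd ho => h.not_occ i hi.of_succ hc k hk hkd ho.of_succ,
    fun i j hi hic hj hjc => h.agree i j hi.of_succ hic hj.of_succ hjc,
    fun i hi hc => h.mat i hi.of_succ hc⟩

namespace SpecialWord

variable {w ρ : ℕ → ℕ} {n₀ a b : ℕ}

theorem exists_pred (h : SpecialWord w ρ n₀ a b) {N : ℕ} (hN : n₀ ≤ N) {d d' : ℕ}
    {g g' : Matrix (Fin 2) (Fin 2) ℤ} (hA : IsReturn w ρ N a d g) (hB : IsReturn w ρ N b d' g') :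
    ∃ m, ∀ j, m ≤ j → Occ w ρ N j →
      ∃ i, Occ w ρ N i ∧ ((w i = a ∧ j = i + d) ∨ (w i = b ∧ j = i + d')) := by
  classical
  obtain ⟨i₀, hi₀, -⟩ := h.exists_left N hN
  refine ⟨i₀ + 1, fun j hj hocc => ?_⟩
  set i := Nat.findGreatest (fun i => Occ w ρ N i) (j - 1)
  have hi : Occ w ρ N i := Nat.findGreatest_spec (P := fun i => Occ w ρ N i) (by omega) hi₀
  have hij : i ≤ j - 1 := Nat.findGreatest_le _
  have hgr : ∀ k, i < k → k ≤ j - 1 → ¬ Occ w ρ N k := fun k hk hk' =>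
    Nat.findGreatest_is_greatest (P := fun i => Occ w ρ N i) hk hk'
  have aux : ∀ {c d : ℕ} {g : Matrix (Fin 2) (Fin 2) ℤ}, IsReturn w ρ N c d g → w i = c →
      j = i + d := by
    intro c d g hR hc
    have hd := hR.pos
    rcases lt_trichotomy j (i + d) with hlt | heq | hlt
    · exact absurd (by rwa [Nat.add_sub_cancel' (by omega)])
        (hR.not_occ i hi hc (j - i) (by omega) (by omega))
    · exact heq
    · exact absurd (hR.occ i hi hc) (hgr _ (by omega) (by omega))
  refine ⟨i, hi, ?_⟩
  rcases h.letter hN hi with hc | hc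
  · exact Or.inl ⟨hc, aux hA hc⟩
  · exact Or.inr ⟨hc, aux hB hc⟩

/-- A `b`-return ends at the special factor of length `N` but not at the longer one, so the letter
after it is forced. If that letter were `b`, the returns would repeat forever with period `d'`;
hence it is `a`, and an `a`-return completes the longer return. -/
theorem step_aux (h : SpecialWord w ρ n₀ a b) (hw : NoLongPeriod w) {N : ℕ} (hN : n₀ ≤ N)
    {d d' : ℕ} {g g' : Matrix (Fin 2) (Fin 2) ℤ} (hA : IsReturn w ρ N a d g)
    (hB : IsReturn w ρ N b d' g')
    (hAocc : ∀ i, Occ w ρ N i → w i = a → Occ w ρ (N + 1) (i + d))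
    (hBocc : ∀ i, Occ w ρ N i → w i = b → ¬ Occ w ρ (N + 1) (i + d')) :
    IsReturn w ρ (N + 1) b (d' + d) (g * g') ∧
      ∃ m, ∀ j, m ≤ j → Occ w ρ (N + 1) j → ∃ i, Occ w ρ N i ∧ w i = a ∧ j = i + d := by
  have hnext : ∀ i, Occ w ρ N i → w i = b → w (i + d') = a := by
    intro i₀ hi₀ hb₀
    by_contra hna
    have hsame : ∀ i, Occ w ρ N i → w i = b → w (i + d') = b := by
      intro i hi hb
      have hb' := (h.letter hN (hB.occ i₀ hi₀ hb₀)).resolve_left hna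
      rw [← hb']
      by_contra hne
      refine hBocc i hi hb (h.special (N + 1) (by omega) _ _ ?_ hne).1
      exact ((hi.agreeLeft hi₀).extend (hB.agree i i₀ hi hb hi₀ hb₀)).mono
        (by have := hB.pos; omega)
    have hall : ∀ k, Occ w ρ N (i₀ + d' * k) ∧ w (i₀ + d' * k) = b := by
      intro k
      induction k with
      | zero => exact ⟨hi₀, hb₀⟩
      | succ k ih =>
        rw [mul_add, mul_one, ← add_assoc]
        exact ⟨hB.occ _ ih.1 ih.2, hsame _ ih.1 ih.2⟩
    obtain ⟨L, hL⟩ := hw d' hB.pos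
    refine hL i₀ fun i _ => ?_
    have h1 := hB.agree _ _ (hall (i / d' + 1)).1 (hall (i / d' + 1)).2 (hall (i / d')).1
      (hall (i / d')).2 (i % d') (Nat.mod_lt _ hB.pos)
    have h2 := Nat.div_add_mod i d'
    rw [show i₀ + i + d' = i₀ + d' * (i / d' + 1) + i % d' by rw [mul_add]; omega, h1]
    congr 1; omega
  refine ⟨⟨by have := hA.pos; omega, fun i hi hb => ?_, fun i hi hb k hk hkd ho => ?_,
    fun i j hi hib hj hjb => ?_, fun i hi hb => ?_⟩, ?_⟩
  · rw [← add_assoc]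
    exact hAocc _ (hB.occ i hi.of_succ hb) (hnext i hi.of_succ hb)
  · rcases lt_trichotomy k d' with hlt | rfl | hlt
    · exact hB.not_occ i hi.of_succ hb k hk hlt ho.of_succ
    · exact hBocc i hi.of_succ hb ho
    · refine hA.not_occ _ (hB.occ i hi.of_succ hb) (hnext i hi.of_succ hb) (k - d') (by omega)
        (by omega) ?_
      rw [show i + d' + (k - d') = i + k by omega]
      exact ho.of_succ
  · intro k hk
    by_cases hkd : k < d'
    · exact hB.agree i j hi.of_succ hib hj.of_succ hjb k hkd
    · have := hA.agree _ _ (hB.occ i hi.of_succ hib) (hnext i hi.of_succ hib)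
        (hB.occ j hj.of_succ hjb) (hnext j hj.of_succ hjb) (k - d') (by omega)
      rwa [show i + d' + (k - d') = i + k by omega, show j + d' + (k - d') = j + k by omega] at this
  · rw [blockMat_add, hB.mat i hi.of_succ hb,
      hA.mat _ (hB.occ i hi.of_succ hb) (hnext i hi.of_succ hb)]
  · obtain ⟨m, hm⟩ := h.exists_pred hN hA hB
    refine ⟨m, fun j hj ho => ?_⟩
    obtain ⟨i, hi, ⟨hc, rfl⟩ | ⟨hc, rfl⟩⟩ := hm j hj ho.of_succ
    · exact ⟨i, hi, hc, rfl⟩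
    · exact absurd ho (hBocc i hi hc)

/-- Passing from the special factor of length `N` to that of length `N + 1`, at most one of the
two return words changes, by absorbing the other one. -/
theorem step (h : SpecialWord w ρ n₀ a b) (hw : NoLongPeriod w) {D : ℕ} (hD : ∀ n, w n ≤ D)
    {N : ℕ} (hN : n₀ ≤ N) {d d' : ℕ} {g g' : Matrix (Fin 2) (Fin 2) ℤ}
    (hA : IsReturn w ρ N a d g) (hB : IsReturn w ρ N b d' g') :
    (IsReturn w ρ (N + 1) a d g ∧ IsReturn w ρ (N + 1) b d' g') ∨
    (IsReturn w ρ (N + 1) a d g ∧ IsReturn w ρ (N + 1) b (d' + d) (g * g') ∧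
      ∃ m, ∀ j, m ≤ j → Occ w ρ (N + 1) j → ∃ i, Occ w ρ N i ∧ w i = a ∧ j = i + d) ∨
    (IsReturn w ρ (N + 1) a (d + d') (g' * g) ∧ IsReturn w ρ (N + 1) b d' g' ∧
      ∃ m, ∀ j, m ≤ j → Occ w ρ (N + 1) j → ∃ i, Occ w ρ N i ∧ w i = b ∧ j = i + d') := by
  -- Whether a return ends at the longer special factor depends only on its letter. If neither did,
  -- the longer factor would not recur.
  have dich : ∀ {c d : ℕ} {g : Matrix (Fin 2) (Fin 2) ℤ}, IsReturn w ρ N c d g →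
      (∀ i, Occ w ρ N i → w i = c → Occ w ρ (N + 1) (i + d)) ∨
      (∀ i, Occ w ρ N i → w i = c → ¬ Occ w ρ (N + 1) (i + d)) := by
    intro c d g hR
    by_contra hcon
    push Not at hcon
    obtain ⟨⟨i, hi, hic, hno⟩, j, hj, hjc, hyes⟩ := hcon
    exact hno (hR.occ_succ_iff hj hjc hi hic hyes)
  rcases dich hA with hA' | hA' <;> rcases dich hB with hB' | hB'
  · exact Or.inl ⟨hA.succ_of_occ hA', hB.succ_of_occ hB'⟩
  · exact Or.inr (Or.inl ⟨hA.succ_of_occ hA', h.step_aux hw hN hA hB hA' hB'⟩)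
  · obtain ⟨h1, h2⟩ := h.symm.step_aux hw hN hB hA hB' hA'
    exact Or.inr (Or.inr ⟨h1, hB.succ_of_occ hB', h2⟩)
  · exfalso
    obtain ⟨m, hm⟩ := h.exists_pred hN hA hB
    obtain ⟨j, hj, hocc⟩ := h.exists_occ_ge hw hD (show n₀ ≤ N + 1 by omega) m
    obtain ⟨i, hi, ⟨hc, rfl⟩ | ⟨hc, rfl⟩⟩ := hm j hj hocc.of_succ
    · exact hA' i hi hc hocc
    · exact hB' i hi hc hocc

end SpecialWord

/-- The return length cannot be the same for all `N`. -/
theorem NoLongPeriod.not_isReturn {w ρ : ℕ → ℕ} (hw : NoLongPeriod w) {c d : ℕ} (hd : 1 ≤ d)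
    (hex : ∀ M, ∃ N, M ≤ N ∧ ∃ g, IsReturn w ρ N c d g ∧ ∃ i, Occ w ρ N i ∧ w i = c) : False := by
  obtain ⟨L, hL⟩ := hw d hd
  obtain ⟨N, hN, g, hR, i, hi, hc⟩ := hex L
  obtain ⟨h1, h2, h3⟩ := (hR.occ i hi hc).agreeLeft hi
  refine hL (i - N) fun k hk => ?_
  rw [← h3 k (by omega)]
  congr 1; omega

/-! ### Recurrent states modulo an integer -/

/-- The action of integral matrices on vectors modulo `q`. -/
def modAct (q : ℕ) (g : Matrix (Fin 2) (Fin 2) ℤ) (v : Fin 2 → ZMod q) : Fin 2 → ZMod q :=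
  g.map (Int.cast : ℤ → ZMod q) *ᵥ v

theorem modAct_mul (q : ℕ) (g h : Matrix (Fin 2) (Fin 2) ℤ) (v : Fin 2 → ZMod q) :
    modAct q (g * h) v = modAct q g (modAct q h v) := by
  rw [modAct, modAct, modAct, Matrix.mulVec_mulVec, ← Matrix.map_mul_intCast]

theorem modAct_one (q : ℕ) (v : Fin 2 → ZMod q) : modAct q 1 v = v := by
  rw [modAct, Matrix.map_one _ Int.cast_zero Int.cast_one, Matrix.one_mulVec]

theorem modAct_intCast (q : ℕ) (g : Matrix (Fin 2) (Fin 2) ℤ) (v : Fin 2 → ℤ) :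
    modAct q g (fun i => (v i : ZMod q)) = fun i => ((g *ᵥ v) i : ZMod q) := by
  ext i
  simp [modAct, Matrix.mulVec, dotProduct]

theorem modAct_injective (q : ℕ) {g : Matrix (Fin 2) (Fin 2) ℤ} (hg : g.det ^ 2 = 1) :
    Function.Injective (modAct q g) := by
  have hu : IsUnit g.det := IsUnit.of_mul_eq_one _ (by rw [← pow_two]; exact hg)
  intro u v huv
  have := congrArg (modAct q g⁻¹) huv
  rwa [← modAct_mul, ← modAct_mul, Matrix.nonsing_inv_mul g hu, modAct_one, modAct_one] at this

theorem exists_frequently_of_finite {α ι : Type*} [Finite α] {l : Filter ι} {P : ι → α → Prop}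
    (h : ∃ᶠ i in l, ∃ v, P i v) : ∃ v, ∃ᶠ i in l, P i v := by
  by_contra hcon
  push Not at hcon
  exact h ((eventually_all.mpr hcon).mono fun i hi ⟨v, hv⟩ => hi v hv)

/-- The states modulo `q` along `w` that recur at occurrences of the special factors form a set
invariant under both return matrices. -/
theorem SpecialWord.exists_invariant {w ρ : ℕ → ℕ} {n₀ a b : ℕ} (h : SpecialWord w ρ n₀ a b)
    (hw : NoLongPeriod w) {D : ℕ} (hD : ∀ n, w n ≤ D) {d d' : ℕ}
    {g g' : Matrix (Fin 2) (Fin 2) ℤ} (hA : IsReturn w ρ n₀ a d g) (hB : IsReturn w ρ n₀ b d' g')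
    (q : ℕ) [NeZero q] (v₀ : Fin 2 → ZMod q) :
    ∃ V : Set (Fin 2 → ZMod q), V.Nonempty ∧
      (∀ v ∈ V, modAct q g v ∈ V ∧ modAct q g' v ∈ V) ∧
      ∀ v ∈ V, ∃ i, modAct q (blockMat w 0 i) v₀ = v := by
  classical
  set τ : ℕ → Fin 2 → ZMod q := fun i => modAct q (blockMat w 0 i) v₀ with hτdef
  have hτ : ∀ i k, τ (i + k) = modAct q (blockMat w i k) (τ i) := fun i k => by
    simp only [hτdef]; rw [← modAct_mul, blockMat_add, zero_add]
  have hexA := fun N => fun hN : n₀ ≤ N => h.exists_isReturn hw hD hN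
  have hexB := fun N => fun hN : n₀ ≤ N => h.symm.exists_isReturn hw hD hN
  choose! dA gA hRA using hexA
  choose! dB gB hRB using hexB
  let S : ℕ → Set (Fin 2 → ZMod q) := fun N => {v | ∃ᶠ i in atTop, Occ w ρ N i ∧ τ i = v}
  have hSanti : ∀ N M, N ≤ M → S M ⊆ S N := fun N M hNM v hv =>
    Frequently.mono hv fun i hi => ⟨⟨hNM.trans hi.1.1, fun k hk => hi.1.2 k (by omega)⟩, hi.2⟩
  have hSne : ∀ N, n₀ ≤ N → (S N).Nonempty := fun N hN => by
    apply exists_frequently_of_finite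
    rw [frequently_atTop]
    intro m
    obtain ⟨i, hi, hocc⟩ := h.exists_occ_ge hw hD hN m
    exact ⟨i, hi, τ i, hocc, rfl⟩
  -- The sets `S N` decrease inside a finite set, so they stabilise at some `V`.
  obtain ⟨N₁, hN₁⟩ := WellFoundedGT.monotone_chain_condition
    (⟨fun N => OrderDual.toDual (S N), fun N M hNM => hSanti N M hNM⟩ :
      ℕ →o (Set (Fin 2 → ZMod q))ᵒᵈ)
  set N₀ := max n₀ N₁
  have hstab : ∀ N, N₀ ≤ N → S N = S N₀ := fun N hN =>
    ((hN₁ N (by omega)).symm.trans (hN₁ N₀ (by omega)) : _)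
  set V := S N₀
  let Inv : Matrix (Fin 2) (Fin 2) ℤ → Prop := fun x => modAct q x '' V = V
  -- If every late occurrence at level `N + 1` ends a `c`-return, each state of `V` comes from `V`
  -- through `g`. Counting turns the inclusion `V ⊆ g V` into equality.
  have hlate : ∀ N, N₀ ≤ N → ∀ {c d : ℕ} {g : Matrix (Fin 2) (Fin 2) ℤ}, IsReturn w ρ N c d g →
      (∃ m, ∀ j, m ≤ j → Occ w ρ (N + 1) j → ∃ i, Occ w ρ N i ∧ w i = c ∧ j = i + d) → Inv g := by
    intro N hN c d g hR hm
    obtain ⟨m, hm⟩ := hm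
    have hsub : V ⊆ modAct q g '' V := by
      intro v hv
      rw [← hstab (N + 1) (by omega)] at hv
      have : ∃ᶠ i in atTop, ∃ u, (Occ w ρ N i ∧ τ i = u) ∧ modAct q g u = v := by
        rw [frequently_atTop]
        intro k
        obtain ⟨j, hj, hocc, hjv⟩ := (frequently_atTop.mp hv) (max m (k + d))
        obtain ⟨i, hi, hc, rfl⟩ := hm j (by omega) hocc
        exact ⟨i, by omega, τ i, ⟨hi, rfl⟩, by rw [← hR.mat i hi hc, ← hτ, hjv]⟩
      obtain ⟨u, hu⟩ := exists_frequently_of_finite this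
      obtain ⟨i, hi⟩ := hu.exists
      refine ⟨u, ?_, hi.2⟩
      rw [← hstab N hN]
      exact hu.mono fun i hi => hi.1
    exact (Set.eq_of_subset_of_ncard_le hsub (Set.ncard_image_le (Set.toFinite V))
      (Set.toFinite _)).symm
  have hdetA : ∀ N, n₀ ≤ N → (gA N).det ^ 2 = 1 := fun N hN => by
    obtain ⟨i, hi, hc⟩ := h.exists_left N hN
    rw [← (hRA N hN).mat i hi hc]; exact det_blockMat_sq w i _
  have hdetB : ∀ N, n₀ ≤ N → (gB N).det ^ 2 = 1 := fun N hN => by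
    obtain ⟨i, hi, hc⟩ := h.exists_right N hN
    rw [← (hRB N hN).mat i hi hc]; exact det_blockMat_sq w i _
  have huA : ∀ N, n₀ ≤ N → ∀ {d g}, IsReturn w ρ N a d g → d = dA N ∧ g = gA N :=
    fun N hN d g hR => by
      obtain ⟨i, hi, hc⟩ := h.exists_left N hN
      exact hR.unique (hRA N hN) hi hc
  have huB : ∀ N, n₀ ≤ N → ∀ {d g}, IsReturn w ρ N b d g → d = dB N ∧ g = gB N :=
    fun N hN d g hR => by
      obtain ⟨i, hi, hc⟩ := h.exists_right N hN
      exact hR.unique (hRB N hN) hi hc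
  have hstep : ∀ N, n₀ ≤ N →
      ((dA N = dA (N + 1) ∧ gA N = gA (N + 1)) ∧ dB N = dB (N + 1) ∧ gB N = gB (N + 1)) ∨
      ((dA N = dA (N + 1) ∧ gA N = gA (N + 1)) ∧ gA N * gB N = gB (N + 1) ∧
        (N₀ ≤ N → Inv (gA N))) ∨
      ((dB N = dB (N + 1) ∧ gB N = gB (N + 1)) ∧ gB N * gA N = gA (N + 1) ∧
        (N₀ ≤ N → Inv (gB N))) := by
    intro N hN
    have hN' : n₀ ≤ N + 1 := by omega
    rcases h.step hw hD hN (hRA N hN) (hRB N hN) with ⟨h1, h2⟩ | ⟨h1, h2, h3⟩ | ⟨h1, h2, h3⟩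
    · exact Or.inl ⟨huA _ hN' h1, huB _ hN' h2⟩
    · exact Or.inr (Or.inl ⟨huA _ hN' h1, (huB _ hN' h2).2, fun hle => hlate N hle (hRA N hN) h3⟩)
    · exact Or.inr (Or.inr ⟨huB _ hN' h2, (huA _ hN' h1).2, fun hle => hlate N hle (hRB N hN) h3⟩)
  have hcancel : ∀ {x y : Matrix (Fin 2) (Fin 2) ℤ}, x.det ^ 2 = 1 → Inv x → Inv (x * y) →
      Inv y := by
    intro x y hx hix hixy
    apply (modAct_injective q hx).image_injective
    rw [hix, Set.image_image]
    simp only [← modAct_mul]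
    exact hixy
  -- Otherwise the `b`-return would never change again, forcing arbitrarily long stretches of one
  -- period.
  have hA_event : ∀ N, N₀ ≤ N → ∃ M, N ≤ M ∧ Inv (gA M) := by
    intro N hN
    by_contra hcon
    push Not at hcon
    have hconst : ∀ M, N ≤ M → dB M = dB N := by
      intro M hM
      induction M, hM using Nat.le_induction with
      | base => rfl
      | succ M hM ih =>
        rcases hstep M (by omega) with ⟨-, h2, -⟩ | ⟨-, -, h3⟩ | ⟨h2, -⟩
        · rw [← h2, ih]
        · exact absurd (h3 (by omega)) (hcon M hM)
        · rw [← h2.1, ih]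
    refine hw.not_isReturn (hRB N (by omega)).pos (c := b) (ρ := ρ) fun M =>
      ⟨max N M, by omega, gB (max N M), ?_, h.exists_right _ (by omega)⟩
    rw [← hconst (max N M) (by omega)]
    exact hRB _ (by omega)
  -- Once `gA` preserves `V` it stays fixed until it absorbs `gB`; at that moment `gB` preserves `V`
  -- too. Without such a moment the `a`-return would be constant.
  have hboth : ∃ M, N₀ ≤ M ∧ Inv (gA M) ∧ Inv (gB M) := by
    obtain ⟨N, hN, hinv⟩ := hA_event N₀ le_rfl
    by_contra hcon
    push Not at hcon
    have hconst : ∀ M, N ≤ M → dA M = dA N ∧ Inv (gA M) := by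
      intro M hM
      induction M, hM using Nat.le_induction with
      | base => exact ⟨rfl, hinv⟩
      | succ M hM ih =>
        rcases hstep M (by omega) with ⟨h2, -⟩ | ⟨h2, -⟩ | ⟨-, -, h3⟩
        · rw [← h2.1, ← h2.2]; exact ih
        · rw [← h2.1, ← h2.2]; exact ih
        · exact absurd (h3 (by omega)) (hcon M (by omega) ih.2)
    refine hw.not_isReturn (hRA N (by omega)).pos (c := a) (ρ := ρ) fun M =>
      ⟨max N M, by omega, gA (max N M), ?_, h.exists_left _ (by omega)⟩
    rw [← (hconst (max N M) (by omega)).1]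
    exact hRA _ (by omega)
  -- Invariance descends to level `n₀`: each refinement multiplies one matrix by the other, which
  -- acts injectively and can be cancelled.
  have hdown : ∀ k N, n₀ ≤ N → Inv (gA (N + k)) → Inv (gB (N + k)) → Inv (gA N) ∧ Inv (gB N) := by
    intro k
    induction k with
    | zero => exact fun N _ h1 h2 => ⟨h1, h2⟩
    | succ k ih =>
      intro N hN h1 h2
      rw [show N + (k + 1) = N + 1 + k by omega] at h1 h2
      obtain ⟨h3, h4⟩ := ih (N + 1) (by omega) h1 h2
      rcases hstep N hN with ⟨e1, e2⟩ | ⟨e1, e2, -⟩ | ⟨e1, e2, -⟩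
      · rw [e1.2, e2.2]; exact ⟨h3, h4⟩
      · rw [← e2] at h4
        rw [← e1.2] at h3
        exact ⟨h3, hcancel (hdetA N hN) h3 h4⟩
      · rw [← e2] at h3
        rw [← e1.2] at h4
        exact ⟨hcancel (hdetB N hN) h4 h3, h4⟩
  obtain ⟨M, hM, hMA, hMB⟩ := hboth
  obtain ⟨hIA, hIB⟩ := hdown (M - n₀) n₀ le_rfl (by rwa [Nat.add_sub_cancel' (by omega)])
    (by rwa [Nat.add_sub_cancel' (by omega)])
  rw [← (huA n₀ le_rfl hA).2] at hIA
  rw [← (huB n₀ le_rfl hB).2] at hIB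
  refine ⟨V, hSne N₀ (by omega), fun v hv => ⟨?_, ?_⟩, fun v hv => ?_⟩
  · rw [← hIA]; exact ⟨v, hv, rfl⟩
  · rw [← hIB]; exact ⟨v, hv, rfl⟩
  · obtain ⟨i, hi⟩ := hv.exists
    exact ⟨i, hi.2⟩

/-! ### Positive matrices and commutators -/

/-- Matrices whose first column dominates their positive second column. -/
def Dominant (X : Matrix (Fin 2) (Fin 2) ℤ) : Prop :=
  1 ≤ X 0 1 ∧ X 0 1 ≤ X 0 0 ∧ 0 ≤ X 1 1 ∧ X 1 1 ≤ X 1 0 ∧ 1 ≤ X 1 0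

theorem Dominant.mul {X Y : Matrix (Fin 2) (Fin 2) ℤ} (hX : Dominant X) (hY : Dominant Y) :
    Dominant (X * Y) := by
  obtain ⟨x1, x2, x3, x4, x5⟩ := hX
  obtain ⟨y1, y2, y3, y4, y5⟩ := hY
  simp only [Dominant, Matrix.mul_apply, Fin.sum_univ_two]
  refine ⟨?_, ?_, ?_, ?_, ?_⟩ <;> nlinarith [mul_nonneg x3 y3]

theorem dominant_stepMat {a : ℕ} (ha : 1 ≤ a) : Dominant (stepMat a) := by
  simp [Dominant, stepMat]; omega

theorem Dominant.pow {X : Matrix (Fin 2) (Fin 2) ℤ} (hX : Dominant X) (n : ℕ) :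
    Dominant (X ^ (n + 1)) := by
  induction n with
  | zero => simpa using hX
  | succ n ih => rw [pow_succ]; exact ih.mul hX

theorem blockMat_eq_mul_stepMat {w : ℕ → ℕ} (hw : ∀ n, 1 ≤ w n) (i l : ℕ) :
    ∃ X, (X = 1 ∨ Dominant X) ∧ blockMat w i (l + 1) = X * stepMat (w i) := by
  have hdom : ∀ j k, blockMat w j k = 1 ∨ Dominant (blockMat w j k) := by
    intro j k
    induction k with
    | zero => exact Or.inl rfl
    | succ k ih =>
      right
      rw [blockMat]
      rcases ih with ih | ih
      · rw [ih, mul_one]; exact dominant_stepMat (hw _)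
      · exact (dominant_stepMat (hw _)).mul ih
  refine ⟨blockMat w (i + 1) l, hdom _ _, ?_⟩
  rw [add_comm l 1, blockMat_add]
  simp [blockMat]

/-- The top row of the product is `(a x + y, x)` with `1 ≤ y ≤ x`, which determines `a`. -/
theorem Dominant.mul_stepMat_inj {X Y : Matrix (Fin 2) (Fin 2) ℤ} (hX : Dominant X)
    (hY : Dominant Y) {a b : ℕ} (h : X * stepMat a = Y * stepMat b) : a = b := by
  have h0 := congrFun (congrFun h 0) 0
  have h1 := congrFun (congrFun h 0) 1
  simp [stepMat, Matrix.mul_apply, Fin.sum_univ_two] at h0 h1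
  obtain ⟨x1, x2, -⟩ := hX
  obtain ⟨y1, y2, -⟩ := hY
  rw [← h1] at h0 y2
  by_contra hne
  rcases lt_or_gt_of_ne hne with hlt | hlt
  · have : (a : ℤ) + 1 ≤ b := by exact_mod_cast hlt
    nlinarith
  · have : (b : ℤ) + 1 ≤ a := by exact_mod_cast hlt
    nlinarith

/-- The rightmost factor of a product is the first letter read; the two sides end in `stepMat a` and
`stepMat b`, and that factor can be recovered. -/
theorem mul_pow_ne_of_letters {A B X Y : Matrix (Fin 2) (Fin 2) ℤ} {a b : ℕ} (hab : a ≠ b)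
    (ha : 1 ≤ a) (hb : 1 ≤ b) (hX : X = 1 ∨ Dominant X) (hY : Y = 1 ∨ Dominant Y)
    (hA : A = X * stepMat a) (hB : B = Y * stepMat b) (n : ℕ) :
    A ^ (n + 1) * B ^ (n + 1) ≠ B ^ (n + 1) * A ^ (n + 1) := by
  intro h
  have dom : ∀ {A X : Matrix (Fin 2) (Fin 2) ℤ} {a : ℕ}, 1 ≤ a → (X = 1 ∨ Dominant X) →
      A = X * stepMat a → Dominant A := by
    rintro A X a ha (rfl | hX) rfl
    · simpa using dominant_stepMat ha
    · exact hX.mul (dominant_stepMat ha)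
  have dA := dom ha hX hA
  have dB := dom hb hY hB
  have aux : ∀ {A B X : Matrix (Fin 2) (Fin 2) ℤ}, Dominant A → Dominant B →
      (X = 1 ∨ Dominant X) → Dominant (B ^ (n + 1) * (A ^ n * X)) := by
    intro A B X hA hB hX
    have hA' : A ^ n = 1 ∨ Dominant (A ^ n) := by
      cases n with
      | zero => left; simp
      | succ n => right; exact hA.pow n
    rcases hA' with h1 | h1 <;> rcases hX with rfl | h2
    · rw [h1, mul_one, mul_one]; exact hB.pow n
    · rw [h1, one_mul]; exact (hB.pow n).mul h2
    · rw [mul_one]; exact (hB.pow n).mul h1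
    · exact (hB.pow n).mul (h1.mul h2)
  apply hab
  apply (aux dA dB hX).mul_stepMat_inj (aux dB dA hY)
  rw [Matrix.mul_assoc, Matrix.mul_assoc, Matrix.mul_assoc, Matrix.mul_assoc, ← hA, ← hB,
    ← pow_succ, ← pow_succ, h]

/-- For `n ≥ 3`, `n ^ 2 - 4` lies strictly between `(n - 1) ^ 2` and `n ^ 2`. -/
theorem sq_sub_four_mul_sq_ne_sq {n s t : ℤ} (hn : 3 ≤ n) (hs : s ≠ 0) :
    (n ^ 2 - 4) * s ^ 2 ≠ t ^ 2 := by
  intro h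
  obtain ⟨r, rfl⟩ : s ∣ t := by
    rw [← Int.pow_dvd_pow_iff two_ne_zero]; exact Dvd.intro_left _ h
  have h' : n ^ 2 - 4 = r ^ 2 := by
    have : s ^ 2 ≠ 0 := pow_ne_zero 2 hs
    apply mul_right_cancel₀ this
    rw [h]; ring
  have h1 : |r| < n := by
    apply abs_lt_of_sq_lt_sq _ (by linarith)
    linarith
  have h2 : n - 1 < |r| := by
    apply lt_of_pow_lt_pow_left₀ 2 (abs_nonneg r)
    rw [sq_abs]; nlinarith
  omega

/-- The commutator of two matrices is singular only if they commute, provided one of them is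
hyperbolic. -/
theorem Dominant.det_commutator_ne_zero {X Y : Matrix (Fin 2) (Fin 2) ℤ} (hX : Dominant X)
    (hdet : X.det = 1) (htr : 3 ≤ X 0 0 + X 1 1) (hne : X * Y ≠ Y * X) :
    (X * Y - Y * X).det ≠ 0 := by
  intro h
  set C := X * Y - Y * X with hC
  have c1 : C 1 1 = - C 0 0 := by
    simp only [hC, Matrix.sub_apply, Matrix.mul_apply, Fin.sum_univ_two]; ring
  have ctr : C 0 0 * (X 0 0 - X 1 1) + C 0 1 * X 1 0 + C 1 0 * X 0 1 = 0 := by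
    simp only [hC, Matrix.sub_apply, Matrix.mul_apply, Fin.sum_univ_two]; ring
  rw [Matrix.det_fin_two, c1] at h
  rw [Matrix.det_fin_two] at hdet
  by_cases h0 : C 0 0 = 0
  · rw [h0] at h ctr
    have hx10 : X 1 0 ≠ 0 := by have := hX.2.2.2.2; omega
    have hx01 : X 0 1 ≠ 0 := by have := hX.1; omega
    have h2 : C 0 1 = 0 ∧ C 1 0 = 0 := by
      have h3 : C 0 1 * C 1 0 = 0 := by linarith
      rcases mul_eq_zero.mp h3 with h4 | h4 <;> rw [h4] at ctr ⊢ <;> simp_all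
    apply hne
    rw [← sub_eq_zero, ← hC]
    ext i j
    fin_cases i <;> fin_cases j <;> simp [h0, h2, c1]
  -- A singular traceless `C` with `tr (C X) = 0` and `C 0 0 ≠ 0` would make `(tr X)² - 4` a
  -- rational square.
  · apply sq_sub_four_mul_sq_ne_sq htr h0 (t := C 0 1 * X 1 0 - C 1 0 * X 0 1)
    have e : (X 0 0 + X 1 1) ^ 2 - 4 = (X 0 0 - X 1 1) ^ 2 + 4 * (X 0 1 * X 1 0) := by
      linear_combination 4 * hdet
    rw [e]
    linear_combination (C 0 0 * (X 0 0 - X 1 1) - C 0 1 * X 1 0 - C 1 0 * X 0 1) * ctr -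
      4 * X 0 1 * X 1 0 * h

/-- A coprime vector that is an approximate eigenvector of both `X` and `Y` is annihilated
approximately by the commutator. -/
theorem pow_dvd_det_commutator {N : ℤ} {X Y : Matrix (Fin 2) (Fin 2) ℤ} {u : Fin 2 → ℤ}
    (hu : IsCoprime (u 0) (u 1)) (hX : N ∣ wedge u (X *ᵥ u)) (hY : N ∣ wedge u (Y *ᵥ u)) :
    N ∣ (X * Y - Y * X).det := by
  have eig : ∀ Z : Matrix (Fin 2) (Fin 2) ℤ, N ∣ wedge u (Z *ᵥ u) →
      ∃ l, ∀ i, N ∣ (Z *ᵥ u) i - l * u i := by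
    intro Z hZ
    obtain ⟨r, s, hrs⟩ := hu
    refine ⟨r * (Z *ᵥ u) 0 + s * (Z *ᵥ u) 1, fun i => ?_⟩
    fin_cases i
    · show N ∣ (Z *ᵥ u) 0 - (r * (Z *ᵥ u) 0 + s * (Z *ᵥ u) 1) * u 0
      rw [show (Z *ᵥ u) 0 - (r * (Z *ᵥ u) 0 + s * (Z *ᵥ u) 1) * u 0 =
        wedge u (Z *ᵥ u) * (-s) by unfold wedge; linear_combination -(Z *ᵥ u) 0 * hrs]
      exact hZ.mul_right _
    · show N ∣ (Z *ᵥ u) 1 - (r * (Z *ᵥ u) 0 + s * (Z *ᵥ u) 1) * u 1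
      rw [show (Z *ᵥ u) 1 - (r * (Z *ᵥ u) 0 + s * (Z *ᵥ u) 1) * u 1 =
        wedge u (Z *ᵥ u) * r by unfold wedge; linear_combination -(Z *ᵥ u) 1 * hrs]
      exact hZ.mul_right _
  obtain ⟨l, hl⟩ := eig X hX
  obtain ⟨m, hm⟩ := eig Y hY
  set C := X * Y - Y * X with hC
  have hCu : ∀ i, N ∣ (C *ᵥ u) i := by
    intro i
    have e : (C *ᵥ u) i = (X i 0 * ((Y *ᵥ u) 0 - m * u 0) + X i 1 * ((Y *ᵥ u) 1 - m * u 1)) -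
        (Y i 0 * ((X *ᵥ u) 0 - l * u 0) + Y i 1 * ((X *ᵥ u) 1 - l * u 1)) +
        m * ((X *ᵥ u) i - l * u i) - l * ((Y *ᵥ u) i - m * u i) := by
      simp only [hC, Matrix.mulVec, dotProduct, Fin.sum_univ_two, Matrix.sub_apply,
        Matrix.mul_apply]
      ring
    rw [e]
    exact dvd_sub (dvd_add (dvd_sub (dvd_add ((hm 0).mul_left _) ((hm 1).mul_left _))
      (dvd_add ((hl 0).mul_left _) ((hl 1).mul_left _))) ((hl i).mul_left _)) ((hm i).mul_left _)
  apply pow_dvd_of_coprime_smul hu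
  · rw [show C.det * u 0 = C 1 1 * (C *ᵥ u) 0 - C 0 1 * (C *ᵥ u) 1 by
      simp only [Matrix.det_fin_two, Matrix.mulVec, dotProduct, Fin.sum_univ_two]; ring]
    exact dvd_sub ((hCu 0).mul_left _) ((hCu 1).mul_left _)
  · rw [show C.det * u 1 = C 0 0 * (C *ᵥ u) 1 - C 1 0 * (C *ᵥ u) 0 by
      simp only [Matrix.det_fin_two, Matrix.mulVec, dotProduct, Fin.sum_univ_two]; ring]
    exact dvd_sub ((hCu 1).mul_left _) ((hCu 0).mul_left _)

/-! ### Limit words and the contradiction -/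

theorem nat_le_denVec {a : ℕ → ℕ} (ha : ∀ n, 1 ≤ a n) (n : ℕ) :
    (n : ℤ) ≤ denVec a (n + 1) 0 := by
  induction n with
  | zero => have := denVec_bounds ha 0; push_cast; linarith
  | succ n ih =>
    have := denVec_lt_succ ha n
    push_cast
    linarith

/-- By coprimality a vanishing value makes `q_{k-1}` divide `z 0`, but `q_{k-1} ≥ k - 2 > |z 0|`. -/
theorem dotProduct_denVec_ne_zero {a : ℕ → ℕ} (ha : ∀ n, 1 ≤ a n) {z : Fin 2 → ℤ} (hz : z ≠ 0)
    {k : ℕ} (hk : (|z 0| + |z 1|) + 2 < (k : ℤ)) : z ⬝ᵥ denVec a k ≠ 0 := by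
  intro h
  have h0 := abs_nonneg (z 0)
  have h1 := abs_nonneg (z 1)
  obtain ⟨k, rfl⟩ : ∃ l, k = l + 2 := Nat.exists_eq_add_of_le' (by omega)
  have hcop := isCoprime_denVec a (k + 2)
  have hb := denVec_bounds ha (k + 1)
  simp only [dotProduct, Fin.sum_univ_two] at h
  have hle : (k : ℤ) ≤ denVec a (k + 2) 1 := by
    rw [denVec_succ a (k + 1)]
    exact nat_le_denVec ha k
  have hdvd : denVec a (k + 2) 1 ∣ z 0 :=
    hcop.symm.dvd_of_dvd_mul_right (Dvd.intro_left (-z 1) (by linarith))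
  have hz0 : z 0 = 0 := by
    apply Int.eq_zero_of_abs_lt_dvd hdvd
    push_cast at hk
    linarith
  rw [hz0] at h
  have hz1 : z 1 = 0 := by
    have : z 1 * denVec a (k + 2) 1 = 0 := by linarith
    rcases mul_eq_zero.mp this with h | h
    · exact h
    · linarith
  exact hz (by ext i; fin_cases i <;> simp [hz0, hz1])

/-- Every prefix of `w` occurs arbitrarily far in `a`. -/
def IsLimitWord (a w : ℕ → ℕ) : Prop := ∀ L, ∃ᶠ n in atTop, ∀ k < L, a (n + k) = w k

theorem IsLimitWord.exists_apply_eq {a w : ℕ → ℕ} (h : IsLimitWord a w) (n : ℕ) :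
    ∃ m, w n = a m := by
  obtain ⟨m, hm⟩ := (h (n + 1)).exists
  exact ⟨m + n, (hm n (Nat.lt_succ_self n)).symm⟩

theorem BadWord.noLongPeriod {p : ℕ} (hp : p.Prime) {a : ℕ → ℕ} {c : ℝ} (h : BadWord p a c)
    {w : ℕ → ℕ} (hw : IsLimitWord a w) : NoLongPeriod w := by
  intro d hd
  obtain ⟨L, hL⟩ := h.not_periodic hp hd
  refine ⟨L, fun n hper => ?_⟩
  obtain ⟨m, hm, hmatch⟩ := (frequently_atTop.mp (hw (n + L + d))) 1
  refine hL (m + n) (by omega) fun i hi => ?_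
  have h1 := hmatch (n + i + d) (by omega)
  have h2 := hmatch (n + i) (by omega)
  rw [show m + n + i + d = m + (n + i + d) by ring, h1, hper i hi, ← h2, add_assoc]

/-- One value `v` must serve all prefix lengths, because the length needed later depends on `v`. If
each of the finitely many values failed at its own length, the largest of these lengths would have
no match. -/
theorem IsLimitWord.exists_state {a w : ℕ → ℕ} (h : IsLimitWord a w) {α : Type*} [Finite α]
    (f : ℕ → α) : ∃ v, ∀ L, ∃ᶠ n in atTop, (∀ k < L, a (n + k) = w k) ∧ f n = v := by
  by_contra hcon
  push Not at hcon
  choose L hL using hcon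
  obtain ⟨L₀, hL₀⟩ := (Set.finite_range L).bddAbove
  apply h L₀
  filter_upwards [eventually_all.mpr hL] with n hn hmatch
  exact hn (f n) (fun k hk => hmatch k (hk.trans_le (hL₀ ⟨_, rfl⟩))) rfl

theorem IsReturn.eq_mul_stepMat {w ρ : ℕ → ℕ} {N c d i : ℕ} {g : Matrix (Fin 2) (Fin 2) ℤ}
    (h : IsReturn w ρ N c d g) (hw : ∀ n, 1 ≤ w n) (hi : Occ w ρ N i) (hc : w i = c) :
    ∃ X, (X = 1 ∨ Dominant X) ∧ g = X * stepMat c := by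
  obtain ⟨d, rfl⟩ := Nat.exists_eq_add_of_le' h.pos
  rw [← h.mat i hi hc, ← hc]
  exact blockMat_eq_mul_stepMat hw i d

theorem Dominant.three_le_trace_pow {X : Matrix (Fin 2) (Fin 2) ℤ} (hX : Dominant X) {n : ℕ}
    (hn : 0 < n) : 3 ≤ (X ^ (2 * n)) 0 0 + (X ^ (2 * n)) 1 1 := by
  obtain ⟨n, rfl⟩ := Nat.exists_eq_add_of_le' hn
  obtain ⟨x1, x2, x3, x4, x5⟩ := hX.pow n
  rw [mul_comm, pow_mul, pow_two]
  simp only [Matrix.mul_apply, Fin.sum_univ_two]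
  nlinarith

/-- The limit words of a bad word have complexity `P(n)` with `P(n) - n → ∞`. -/
theorem BadWord.tendsto_complexity {p : ℕ} (hp : p.Prime) {a : ℕ → ℕ} {c : ℝ} (h : BadWord p a c)
    {D : ℕ} (hD : ∀ n, a n ≤ D) {w : ℕ → ℕ} (hw : IsLimitWord a w) :
    Tendsto (fun n : ℕ => (complexity w n : ℤ) - (n : ℤ)) atTop atTop := by
  by_contra hcon
  have hwpos : ∀ n, 1 ≤ w n := fun n => by
    obtain ⟨m, hm⟩ := hw.exists_apply_eq n
    rw [hm]; exact h.pos m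
  have hwD : ∀ n, w n ≤ D := fun n => by
    obtain ⟨m, hm⟩ := hw.exists_apply_eq n
    rw [hm]; exact hD m
  have hper := h.noLongPeriod hp hw
  obtain ⟨n₀, hn₀⟩ := exists_complexity_succ hper hwD hcon
  obtain ⟨ρ, l, r, hS⟩ := exists_specialWord hwD hn₀
  obtain ⟨d, A, hA⟩ := hS.exists_isReturn hper hwD le_rfl
  obtain ⟨d', B, hB⟩ := hS.symm.exists_isReturn hper hwD le_rfl
  obtain ⟨i, hi, hil⟩ := hS.exists_left n₀ le_rfl
  obtain ⟨j, hj, hjr⟩ := hS.exists_right n₀ le_rfl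
  obtain ⟨X, hX, hAX⟩ := hA.eq_mul_stepMat hwpos hi hil
  obtain ⟨Y, hY, hBY⟩ := hB.eq_mul_stepMat hwpos hj hjr
  have hl : 1 ≤ l := hil ▸ hwpos i
  have hr : 1 ≤ r := hjr ▸ hwpos j
  have hdetA : A.det ^ 2 = 1 := by rw [← hA.mat i hi hil]; exact det_blockMat_sq w i d
  have hdetB : B.det ^ 2 = 1 := by rw [← hB.mat j hj hjr]; exact det_blockMat_sq w j d'
  have hAdom : Dominant A := by
    rw [hAX]
    rcases hX with rfl | hX
    · rw [one_mul]; exact dominant_stepMat hl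
    · exact hX.mul (dominant_stepMat hl)
  obtain ⟨m₀, hm₀, hpow⟩ := exists_pow_eq_one_add (pow_pos hp.pos 2)
  push_cast at hpow
  obtain ⟨t, ht⟩ := Nat.exists_eq_add_of_le' (show 1 ≤ 2 * m₀ by omega)
  have hne := mul_pow_ne_of_letters hS.ne hl hr hX hY hAX hBY t
  rw [← ht] at hne
  have hAdom' : Dominant (A ^ (2 * m₀)) := by rw [ht]; exact hAdom.pow t
  have hcomm := hAdom'.det_commutator_ne_zero (hpow A hdetA).1 (hAdom.three_le_trace_pow hm₀) hne
  obtain ⟨E, -, hE⟩ := exists_exact_pow hp hcomm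
  obtain ⟨K, M, B₀, hkey⟩ := h.exists_form hp
  -- The order `e` of the wedge is not yet known, but it will satisfy `e ≤ E`, so this modulus
  -- suffices.
  have hq : NeZero (p ^ (E + K)) := ⟨(pow_pos hp.pos _).ne'⟩
  obtain ⟨v₀, hv₀⟩ := hw.exists_state (fun n i => ((denVec a n i : ℤ) : ZMod (p ^ (E + K))))
  obtain ⟨V, ⟨v, hv⟩, hinv, hreach⟩ := hS.exists_invariant hper hwD hA hB (p ^ (E + K)) v₀
  choose! time htime using hreach
  obtain ⟨L, hL⟩ := (Set.toFinite (time '' V)).bddAbove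
  -- A match of length `L` realises every element of `V` as a state of `a` after time `n`; the lower
  -- bound on `n` excludes the vanishing of forms with `|z|² ≤ 4 p^(E+B₀)`.
  obtain ⟨n, hn, hmatch, hstate⟩ := (frequently_atTop.mp (hv₀ L)) (4 * p ^ (E + B₀) + 3)
  have hden : ∀ v ∈ V, (fun i => ((denVec a (n + time v) i : ℤ) : ZMod (p ^ (E + K)))) = v := by
    intro v hv
    have hle := hL ⟨v, hv, rfl⟩
    rw [denVec_add, blockMat_congr (w' := w) (j := 0) (fun k hk => by
      rw [zero_add]; exact hmatch k (by omega)), ← modAct_intCast, hstate, htime v hv]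
  have hinvpow : ∀ g : Matrix (Fin 2) (Fin 2) ℤ, (∀ v ∈ V, modAct (p ^ (E + K)) g v ∈ V) →
      ∀ m, ∀ v ∈ V, modAct (p ^ (E + K)) (g ^ m) v ∈ V := by
    intro g hg m
    induction m with
    | zero => intro v hv; rwa [pow_zero, modAct_one]
    | succ m ih => intro v hv; rw [pow_succ, modAct_mul]; exact ih _ (hg v hv)
  -- If this failed, the engine would give a short form nearly vanishing at a vector `g ^ (2 * m₀ *
  -- m) θ`, which by invariance of `V` is congruent to a genuine late state.
  have main : ∀ g : Matrix (Fin 2) (Fin 2) ℤ, g.det ^ 2 = 1 →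
      (∀ v ∈ V, modAct (p ^ (E + K)) g v ∈ V) →
      (p : ℤ) ^ (E + 1) ∣ wedge (denVec a (n + time v)) (g ^ (2 * m₀) *ᵥ denVec a (n + time v)) := by
    intro g hdet hg
    by_contra hdvd
    have hne : wedge (denVec a (n + time v)) (g ^ (2 * m₀) *ᵥ denVec a (n + time v)) ≠ 0 :=
      fun h0 => hdvd (by rw [h0]; exact dvd_zero _)
    obtain ⟨e, he, he'⟩ := exists_exact_pow hp hne
    have heE : e ≤ E := by
      by_contra hlt
      exact hdvd ((pow_dvd_pow _ (by omega)).trans he)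
    obtain ⟨z, hz, hsize, hzero, m, -, -, -, hm, -⟩ :=
      hkey _ e _ (hpow g hdet).1 (hpow g hdet).2 he he'
    rw [← pow_mul] at hm
    have hv' := hinvpow g hg (2 * m₀ * m) v hv
    have h1 := hden _ hv'
    set k := n + time (modAct (p ^ (E + K)) (g ^ (2 * m₀ * m)) v)
    rw [← congrArg (modAct (p ^ (E + K)) (g ^ (2 * m₀ * m))) (hden v hv), modAct_intCast] at h1
    have h2 : (p : ℤ) ^ (e + K) ∣ z ⬝ᵥ denVec a k := by
      have h3 : ∀ i, (p : ℤ) ^ (e + K) ∣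
          denVec a k i - (g ^ (2 * m₀ * m) *ᵥ denVec a (n + time v)) i := by
        intro i
        refine (pow_dvd_pow _ (by omega : e + K ≤ E + K)).trans ?_
        have h4 := congrFun h1 i
        rw [← sub_eq_zero, ← Int.cast_sub, ZMod.intCast_zmod_eq_zero_iff_dvd] at h4
        exact_mod_cast h4
      have h5 := dvd_add hm (dvd_add ((h3 0).mul_left (z 0)) ((h3 1).mul_left (z 1)))
      rw [show z ⬝ᵥ denVec a k = z ⬝ᵥ (g ^ (2 * m₀ * m) *ᵥ denVec a (n + time v)) +
        (z 0 * (denVec a k 0 - (g ^ (2 * m₀ * m) *ᵥ denVec a (n + time v)) 0) +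
          z 1 * (denVec a k 1 - (g ^ (2 * m₀ * m) *ᵥ denVec a (n + time v)) 1)) by
        simp only [dotProduct, Fin.sum_univ_two]; ring]
      exact h5
    refine dotProduct_denVec_ne_zero h.pos hz ?_ (hzero k h2)
    have hpe : (p : ℤ) ^ (e + B₀) ≤ (p : ℤ) ^ (E + B₀) :=
      pow_le_pow_right₀ (by exact_mod_cast hp.one_le) (by omega)
    have hnk : (4 * (p : ℤ) ^ (E + B₀) + 3) ≤ k := by
      have : 4 * p ^ (E + B₀) + 3 ≤ k := hn.trans (Nat.le_add_right _ _)
      exact_mod_cast this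
    have hsq : |z 0| + |z 1| ≤ (|z 0| + |z 1|) ^ 2 := Int.le_self_sq _
    linarith
  exact hE (pow_dvd_det_commutator (isCoprime_denVec a _)
    (main A hdetA fun v hv => (hinv v hv).1) (main B hdetB fun v hv => (hinv v hv).2))

/-! ### From counterexamples to bad words -/

theorem distInt_nonneg (y : ℝ) : 0 ≤ distInt y := abs_nonneg _

theorem distInt_le (y : ℝ) (m : ℤ) : distInt y ≤ |y - m| := round_le y m

theorem distInt_natAbs_mul_le (x : ℝ) (Q P : ℤ) : distInt ((Q.natAbs : ℝ) * x) ≤ |Q * x - P| := by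
  rw [Nat.cast_natAbs, Int.cast_abs]
  rcases abs_choice (Q : ℝ) with h | h <;> rw [h]
  · exact distInt_le _ _
  · refine (distInt_le _ (-P)).trans (le_of_eq ?_)
    rw [← abs_neg]; congr 1; push_cast; ring

theorem IsCounterexample.eventually_le {p : ℕ} [Fact p.Prime] {x : ℝ} (hx : IsCounterexample p x) :
    ∃ c > 0, ∀ᶠ q : ℕ in atTop, c ≤ (q : ℝ) * ‖(q : ℚ_[p])‖ * distInt ((q : ℝ) * x) := by
  set f : ℕ → ℝ := fun q => (q : ℝ) * ‖(q : ℚ_[p])‖ * distInt ((q : ℝ) * x)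
  have hf : ∀ q, 0 ≤ f q := fun q =>
    mul_nonneg (mul_nonneg (Nat.cast_nonneg _) (norm_nonneg _)) (distInt_nonneg _)
  have hx' : sSup {a | ∀ᶠ q in atTop, a ≤ f q} ≠ 0 := by
    rw [← liminf_eq]; exact hx
  have h0 : (0 : ℝ) ∈ {a | ∀ᶠ q in atTop, a ≤ f q} := Eventually.of_forall hf
  -- The real `sSup` of an unbounded set is `0` by convention, which the hypothesis excludes.
  have hbdd : BddAbove {a | ∀ᶠ q in atTop, a ≤ f q} := by
    by_contra h; exact hx' (Real.sSup_of_not_bddAbove h)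
  obtain ⟨c, hc, hpos⟩ := exists_lt_of_lt_csSup ⟨0, h0⟩
    (lt_of_le_of_ne (le_csSup hbdd h0) hx'.symm)
  exact ⟨c, hpos, hc⟩

theorem IsCounterexample.irrational {p : ℕ} [Fact p.Prime] {x : ℝ} (hx : IsCounterexample p x) :
    Irrational x := by
  obtain ⟨c, hc, h⟩ := hx.eventually_le
  rintro ⟨r, rfl⟩
  obtain ⟨N, hN⟩ := eventually_atTop.mp h
  have h1 := hN (r.den * (N + 1)) (by nlinarith [r.den_pos])
  have h2 : ((r.den * (N + 1) : ℕ) : ℝ) * (r : ℝ) = ((r.num * (N + 1) : ℤ) : ℝ) := by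
    have : (r.den : ℝ) * (r : ℝ) = r.num := by exact_mod_cast Rat.den_mul_eq_num r
    push_cast
    linear_combination ((N : ℝ) + 1) * this
  have h3 : distInt (((r.den * (N + 1) : ℕ) : ℝ) * (r : ℝ)) = 0 := by
    rw [h2, distInt, round_intCast, sub_self, abs_zero]
  rw [h3, mul_zero] at h1
  linarith

theorem IsCounterexample.exists_le {p : ℕ} [Fact p.Prime] {x : ℝ} (hx : IsCounterexample p x) :
    ∃ c > 0, ∀ q : ℕ, 1 ≤ q → c ≤ (q : ℝ) * ‖(q : ℚ_[p])‖ * distInt ((q : ℝ) * x) := by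
  obtain ⟨c, hc, h⟩ := hx.eventually_le
  obtain ⟨N, hN⟩ := eventually_atTop.mp h
  set f : ℕ → ℝ := fun q => (q : ℝ) * ‖(q : ℚ_[p])‖ * distInt ((q : ℝ) * x)
  have hpos : ∀ q, 1 ≤ q → 0 < f q := by
    intro q hq
    have hq' : (q : ℚ_[p]) ≠ 0 := by exact_mod_cast (show q ≠ 0 by omega)
    have hq'' : (0 : ℝ) < q := by exact_mod_cast hq
    refine mul_pos (mul_pos hq'' (norm_pos_iff.mpr hq')) (abs_pos.mpr (sub_ne_zero.mpr ?_))
    exact (hx.irrational.natCast_mul (by omega : q ≠ 0)).ne_int _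
  have hfin : ∀ N : ℕ, ∃ c' > 0, ∀ q, 1 ≤ q → q < N → c' ≤ f q := by
    intro N
    induction N with
    | zero => exact ⟨1, one_pos, fun q _ hq => by omega⟩
    | succ N ih =>
      obtain ⟨c', hc', h'⟩ := ih
      by_cases hN0 : 1 ≤ N
      · refine ⟨min c' (f N), lt_min hc' (hpos N hN0), fun q hq hqN => ?_⟩
        rcases Nat.lt_succ_iff_lt_or_eq.mp hqN with hlt | rfl
        · exact (min_le_left _ _).trans (h' q hq hlt)
        · exact min_le_right _ _
      · exact ⟨1, one_pos, fun q hq hqN => by omega⟩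
  obtain ⟨c', hc', h'⟩ := hfin N
  refine ⟨min c c', lt_min hc hc', fun q hq => ?_⟩
  rcases lt_or_ge q N with hlt | hge
  · exact (min_le_right _ _).trans (h' q hq hlt)
  · exact (min_le_left _ _).trans (hN q hge)

open GenContFract in
-- The expansion of an irrational never terminates, so the default value in `cfWord` is not reached,
-- and its floor is exact.
theorem get?_of_irrational {x : ℝ} (hx : Irrational x) (n : ℕ) :
    (GenContFract.of x).s.get? n = some ⟨1, (cfWord x n : ℝ)⟩ ∧ 1 ≤ cfWord x n := by
  have hnt : ¬ (GenContFract.of x).TerminatedAt n := fun h =>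
    hx (by obtain ⟨q, hq⟩ := (terminates_iff_rat x).mp ⟨n, h⟩; exact ⟨q, hq.symm⟩)
  obtain ⟨⟨α, β⟩, hs⟩ : ∃ gp, (GenContFract.of x).s.get? n = some gp :=
    Option.ne_none_iff_exists'.mp hnt
  obtain ⟨ha, m, hm⟩ := of_partNum_eq_one_and_exists_int_partDen_eq hs
  have hden : (GenContFract.of x).partDens.get? n = some β := partDen_eq_s_b hs
  have h1 := of_one_le_get?_partDen hden
  simp only at ha hm
  subst ha hm
  have hm1 : 1 ≤ m := by exact_mod_cast h1
  have hcf : cfWord x n = m.toNat := by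
    rw [cfWord, hden, Option.getD_some, ← Int.floor_toNat, Int.floor_intCast]
  have hcast : ((cfWord x n : ℕ) : ℝ) = m := by
    rw [hcf]; exact_mod_cast Int.toNat_of_nonneg (by omega : 0 ≤ m)
  exact ⟨by rw [hs, hcast], by omega⟩

theorem dens_eq_denVec {x : ℝ} (hx : Irrational x) (n : ℕ) :
    (GenContFract.of x).dens n = denVec (cfWord x) n 0 := by
  induction n using Nat.twoStepInduction with
  | zero => simp [denVec_zero]
  | one =>
    rw [GenContFract.first_den_eq (get?_of_irrational hx 0).1, denVec_succ, denVec_zero]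
    simp
  | more n h1 h2 =>
    rw [GenContFract.dens_recurrence (get?_of_irrational hx (n + 1)).1 h1 h2,
      denVec_succ _ (n + 1)]
    simp only [Matrix.cons_val_zero]
    rw [show denVec (cfWord x) (n + 1) 1 = denVec (cfWord x) n 0 by rw [denVec_succ]; simp]
    push_cast; ring

theorem exists_int_eq_nums {x : ℝ} (hx : Irrational x) (n : ℕ) :
    ∃ P : ℤ, (GenContFract.of x).nums n = P := by
  induction n using Nat.twoStepInduction with
  | zero => exact ⟨⌊x⌋, by simp [GenContFract.of_h_eq_floor]⟩
  | one =>
    rw [GenContFract.first_num_eq (get?_of_irrational hx 0).1, GenContFract.of_h_eq_floor]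
    exact ⟨cfWord x 0 * ⌊x⌋ + 1, by push_cast; ring⟩
  | more n h1 h2 =>
    obtain ⟨P, hP⟩ := h1
    obtain ⟨P', hP'⟩ := h2
    rw [GenContFract.nums_recurrence (get?_of_irrational hx (n + 1)).1 hP hP']
    exact ⟨cfWord x (n + 1) * P' + P, by push_cast; ring⟩

theorem denVec_pos {a : ℕ → ℕ} (ha : ∀ n, 1 ≤ a n) (n : ℕ) : 0 < denVec a n 0 := by
  cases n with
  | zero => simp [denVec_zero]
  | succ n => have := denVec_bounds ha n; omega

/-- The quality of approximation by convergents. -/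
theorem exists_abs_denVec_mul_sub_le {x : ℝ} (hx : Irrational x) (n : ℕ) :
    ∃ P : ℤ, |(denVec (cfWord x) n 0 : ℝ) * x - P| ≤ 1 / denVec (cfWord x) (n + 1) 0 := by
  have hpos := denVec_pos (fun n => (get?_of_irrational hx n).2) n
  have hposR : (0 : ℝ) < denVec (cfWord x) n 0 := by exact_mod_cast hpos
  obtain ⟨P, hP⟩ := exists_int_eq_nums hx n
  refine ⟨P, ?_⟩
  have hnt : ¬ (GenContFract.of x).TerminatedAt n := fun h => by
    have := (get?_of_irrational hx n).1
    rw [GenContFract.TerminatedAt, Stream'.Seq.TerminatedAt] at h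
    rw [h] at this; cases this
  have h := GenContFract.abs_sub_convs_le hnt
  rw [GenContFract.conv_eq_num_div_den, hP, dens_eq_denVec hx, dens_eq_denVec hx] at h
  have e : (denVec (cfWord x) n 0 : ℝ) * x - P =
      denVec (cfWord x) n 0 * (x - P / denVec (cfWord x) n 0) := by
    field_simp
  rw [e, abs_mul, abs_of_pos hposR]
  refine (mul_le_mul_of_nonneg_left h hposR.le).trans (le_of_eq ?_)
  rw [one_div, mul_inv, ← mul_assoc, mul_inv_cancel₀ hposR.ne', one_mul, one_div]

/-- Both `q_n x` and `q_{n-1} x` lie within `1 / q_n` of integers, with `q_{-1} = 0`. -/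
theorem exists_abs_dotProduct_mul_sub_le {x : ℝ} (hx : Irrational x) (n : ℕ) (z : Fin 2 → ℤ) :
    ∃ P : ℤ, |((z ⬝ᵥ denVec (cfWord x) n : ℤ) : ℝ) * x - P| ≤
      (|z 0| + |z 1| : ℤ) / denVec (cfWord x) n 0 := by
  have ha := fun n => (get?_of_irrational hx n).2
  have hpos := denVec_pos ha n
  have hposR : (0 : ℝ) < denVec (cfWord x) n 0 := by exact_mod_cast hpos
  have h0 : ∃ P : ℤ, |(denVec (cfWord x) n 0 : ℝ) * x - P| ≤ 1 / denVec (cfWord x) n 0 := by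
    obtain ⟨P, hP⟩ := exists_abs_denVec_mul_sub_le hx n
    refine ⟨P, hP.trans (one_div_le_one_div_of_le hposR ?_)⟩
    cases n with
    | zero =>
      have := denVec_bounds ha 0
      rw [denVec_zero]
      exact_mod_cast this.1.trans this.2
    | succ n => exact_mod_cast (denVec_lt_succ ha n).le
  have h1 : ∃ P : ℤ, |(denVec (cfWord x) n 1 : ℝ) * x - P| ≤ 1 / denVec (cfWord x) n 0 := by
    cases n with
    | zero => exact ⟨0, by simp [denVec_zero]⟩
    | succ n =>
      obtain ⟨P, hP⟩ := exists_abs_denVec_mul_sub_le hx n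
      refine ⟨P, ?_⟩
      rwa [show denVec (cfWord x) (n + 1) 1 = denVec (cfWord x) n 0 by rw [denVec_succ]; simp]
  obtain ⟨P₀, hP₀⟩ := h0
  obtain ⟨P₁, hP₁⟩ := h1
  refine ⟨z 0 * P₀ + z 1 * P₁, ?_⟩
  have e : ((z ⬝ᵥ denVec (cfWord x) n : ℤ) : ℝ) * x - ((z 0 * P₀ + z 1 * P₁ : ℤ) : ℝ) =
      z 0 * ((denVec (cfWord x) n 0 : ℝ) * x - P₀) +
        z 1 * ((denVec (cfWord x) n 1 : ℝ) * x - P₁) := by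
    simp only [dotProduct, Fin.sum_univ_two]; push_cast; ring
  rw [e]
  refine (abs_add_le _ _).trans ?_
  rw [abs_mul, abs_mul, div_eq_mul_one_div]
  push_cast
  rw [add_mul]
  exact add_le_add (mul_le_mul_of_nonneg_left hP₀ (abs_nonneg _))
    (mul_le_mul_of_nonneg_left hP₁ (abs_nonneg _))

/-- The partial quotients of a counterexample form a bad word. -/
theorem IsCounterexample.exists_badWord {p : ℕ} [hp : Fact p.Prime] {x : ℝ}
    (hx : IsCounterexample p x) :
    ∃ c D, BadWord p (cfWord x) c ∧ ∀ n, cfWord x n ≤ D := by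
  have hirr := hx.irrational
  have ha := fun n => (get?_of_irrational hirr n).2
  obtain ⟨c, hc, hbad⟩ := hx.exists_le
  obtain ⟨D, hD⟩ := exists_nat_ge (1 / c)
  refine ⟨c, D, ⟨ha, hc, fun n z K hne hdvd => ?_⟩, fun n => ?_⟩
  · set Q := z ⬝ᵥ denVec (cfWord x) n with hQ
    obtain ⟨P, hP⟩ := exists_abs_dotProduct_mul_sub_le hirr n z
    rw [← hQ] at hP
    have h1 := hbad Q.natAbs (Int.natAbs_pos.mpr hne)
    have hpos := denVec_pos ha n
    have hposR : (0 : ℝ) < denVec (cfWord x) n 0 := by exact_mod_cast hpos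
    have hpR : (0 : ℝ) < (p : ℝ) ^ K := pow_pos (by exact_mod_cast hp.out.pos) K
    have hnorm : ‖((Q.natAbs : ℕ) : ℚ_[p])‖ ≤ ((p : ℝ) ^ K)⁻¹ := by
      have h2 := (Padic.norm_int_le_pow_iff_dvd (p := p) (Q.natAbs : ℤ) K).mpr
        (by rw [Int.dvd_natAbs]; exact_mod_cast hdvd)
      rw [_root_.zpow_neg, _root_.zpow_natCast] at h2
      rwa [Int.cast_natCast] at h2
    have hsize : (Q.natAbs : ℝ) ≤ (|z 0| + |z 1| : ℤ) * denVec (cfWord x) n 0 := by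
      have hle : denVec (cfWord x) n 1 ≤ denVec (cfWord x) n 0 ∧ 0 ≤ denVec (cfWord x) n 1 := by
        cases n with
        | zero => simp [denVec_zero]
        | succ n => have := denVec_bounds ha n; omega
      have : |Q| ≤ (|z 0| + |z 1|) * denVec (cfWord x) n 0 := by
        rw [hQ]
        simp only [dotProduct, Fin.sum_univ_two]
        refine (abs_add_le _ _).trans ?_
        rw [abs_mul, abs_mul, abs_of_pos hpos, abs_of_nonneg hle.2, add_mul]
        exact add_le_add le_rfl (mul_le_mul_of_nonneg_left hle.1 (abs_nonneg _))
      rw [Nat.cast_natAbs]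
      exact_mod_cast this
    have hS : (0 : ℝ) ≤ ((|z 0| + |z 1| : ℤ) : ℝ) := by
      exact_mod_cast add_nonneg (abs_nonneg _) (abs_nonneg _)
    have hprod : (Q.natAbs : ℝ) * ‖((Q.natAbs : ℕ) : ℚ_[p])‖ * distInt ((Q.natAbs : ℝ) * x) ≤
        ((|z 0| + |z 1| : ℤ) * denVec (cfWord x) n 0) * ((p : ℝ) ^ K)⁻¹ *
          ((|z 0| + |z 1| : ℤ) / denVec (cfWord x) n 0) := by
      apply mul_le_mul _ ((distInt_natAbs_mul_le x Q P).trans hP) (distInt_nonneg _) (by positivity)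
      exact mul_le_mul hsize hnorm (norm_nonneg _) (by positivity)
    have h3 := h1.trans hprod
    rw [show ((|z 0| + |z 1| : ℤ) * denVec (cfWord x) n 0 : ℝ) * ((p : ℝ) ^ K)⁻¹ *
          ((|z 0| + |z 1| : ℤ) / denVec (cfWord x) n 0) =
          ((|z 0| + |z 1| : ℤ) : ℝ) ^ 2 / (p : ℝ) ^ K by field_simp] at h3
    rwa [le_div_iff₀ hpR] at h3
  -- Bounded partial quotients: `c ≤ q_n ‖q_n x‖ ≤ q_n / q_{n+1}`, and `q_{n+1}` is at least the
  -- partial quotient times `q_n`.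
  · obtain ⟨P, hP⟩ := exists_abs_denVec_mul_sub_le hirr n
    have hpos := denVec_pos ha n
    have hposR : (0 : ℝ) < denVec (cfWord x) n 0 := by exact_mod_cast hpos
    have h1 := hbad (denVec (cfWord x) n 0).natAbs (Int.natAbs_pos.mpr hpos.ne')
    have h2 := (distInt_natAbs_mul_le x (denVec (cfWord x) n 0) P).trans hP
    have hcast : (((denVec (cfWord x) n 0).natAbs : ℕ) : ℝ) = denVec (cfWord x) n 0 := by
      rw [Nat.cast_natAbs, abs_of_pos hpos]
    rw [hcast] at h1 h2
    have hnorm : ‖(((denVec (cfWord x) n 0).natAbs : ℕ) : ℚ_[p])‖ ≤ 1 := by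
      rw [← Int.cast_natCast]; exact Padic.norm_int_le_one _
    have h3 : c ≤ denVec (cfWord x) n 0 * 1 * (1 / denVec (cfWord x) (n + 1) 0) :=
      h1.trans (mul_le_mul (mul_le_mul_of_nonneg_left hnorm hposR.le) h2 (distInt_nonneg _)
        (by positivity))
    have hpos' : (0 : ℝ) < denVec (cfWord x) (n + 1) 0 := by exact_mod_cast denVec_pos ha (n + 1)
    rw [mul_one, mul_one_div, le_div_iff₀ hpos'] at h3
    have h4 : (cfWord x n : ℝ) * denVec (cfWord x) n 0 ≤ denVec (cfWord x) (n + 1) 0 := by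
      have hle : 0 ≤ denVec (cfWord x) n 1 := by
        cases n with
        | zero => simp [denVec_zero]
        | succ n => have := denVec_bounds ha n; omega
      rw [denVec_succ]
      simp only [Matrix.cons_val_zero]
      exact_mod_cast le_add_of_nonneg_right hle
    have h5 : (cfWord x n : ℝ) * c ≤ 1 := by
      have := (mul_le_mul_of_nonneg_left h4 hc.le).trans h3
      by_contra hlt
      push Not at hlt
      nlinarith
    have h6 : (cfWord x n : ℝ) ≤ D := by
      rw [← le_div_iff₀ hc] at h5
      exact h5.trans hD
    exact_mod_cast h6

theorem isLimitWord_of_mem_limitWords {x : ℝ} {w : ℕ → ℕ} (hw : w ∈ limitWords x) :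
    IsLimitWord (cfWord x) w := by
  intro L
  have hmem : {v : ℕ → ℕ | ∀ k < L, v k = w k} ∈ 𝓝 w := by
    have := set_pi_mem_nhds (Set.finite_Iio L) (x := w) (s := fun k => {w k})
      fun k _ => (isOpen_discrete {w k}).mem_nhds rfl
    exact this
  exact mapClusterPt_iff_frequently.mp hw _ hmem

end PLC

theorem mainTheorem3 (p : ℕ) [Fact p.Prime] (x : ℝ) (hx : PLC.IsCounterexample p x) :
    (∀ w ∈ PLC.limitWords x,
      Tendsto (fun n : ℕ => (PLC.complexity w n : ℤ) - (n : ℤ)) atTop atTop) ∧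
    (∀ w ∈ PLC.limitWords x, ¬ PLC.IsSturmian w) := by
  have hmain : ∀ w ∈ PLC.limitWords x,
      Tendsto (fun n : ℕ => (PLC.complexity w n : ℤ) - (n : ℤ)) atTop atTop := by
    intro w hw
    obtain ⟨c, D, hbad, hD⟩ := hx.exists_badWord
    exact hbad.tendsto_complexity Fact.out hD (PLC.isLimitWord_of_mem_limitWords hw)
  refine ⟨hmain, fun w hw hs => ?_⟩
  obtain ⟨n, hn⟩ := ((hmain w hw).eventually_ge_atTop 2).exists
  rw [hs n] at hn
  push_cast at hn
  omega
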